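/- **Setting.** Let $X$ be a measurable space, $\mu$ a probability distribution on $X$ (the real distribution), $\mathcal G$ a set of probability distributions on $X$ (the generators), and $\mathcal F$ a non-empty set of measurable functions $X\to\mathbb R$ (the discriminators) such that * $\mathcal F$ is even ($f\in\mathcal F\Rightarrow -f\in\mathcal F$) and $\|f\|_\infty\le\Delta$ for all $f\in\mathcal F$; * $\mathcal F=\{f_\theta:\theta\in\Theta\}$ with $\Theta\subseteq[-1,1]^p$ and $\|f_\theta-f_{\theta'}\|_\infty\le L\|\theta-\theta'\|_2$, where $L\ge 0$. Put $d_{\mathcal F}(\mu,\nu)=\sup_{f\in\mathcal F}(\mathbb E_\mu f-\mathbb E_\nu f)$, $\operatorname{span}\mathcal F=\{w_0+\sum_{i=1}^n w_if_i: n\in\mathbb N,\ w_i\in\mathbb R,\ f_i\in\mathcal F\}$, and $\|h\|_{\mathcal F,1}=\inf\{\sum_{i=1}^n|w_i| : h=w_0+\sum_{i=1}^n w_if_i,\ f_i\in\mathcal F\}$ (equalities $\mu$-almost everywhere). Write $\rho_\nu$ for the density of $\nu$. Assume that for every $\nu\in\mathcal G$ the measures $\mu$ and $\nu$ are mutually absolutely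 continuous with $\log(\rho_\mu/\rho_\nu)\in\operatorname{span}\mathcal F$, and that $\Gamma_\mu=\sup_{\nu\in\mathcal G}\|\log(\rho_\mu/\rho_\nu)\|_{\mathcal F,1}<\infty$. Let $0<\delta<1$ and let $x_1,\dots,x_m$ ($m\ge1$) be i.i.d. training samples from $\mu$ with empirical distribution $\hat\mu_m$. Let $g_\alpha\in\mathcal G$ be the trained generator, which may depend on the samples and on further randomness in any way, subject to $d_{\mathcal F}(\hat\mu_m,g_\alpha)-\inf_{\nu\in\mathcal G}d_{\mathcal F}(\hat\mu_m,\nu)\le\tau_{\rm opt}$ almost surely. Put $$C_\delta=16\sqrt{2\pi}\,pL+2\Delta\sqrt{2\log(1/\delta)},\quad \varepsilon_{\mathcal F}(m,\delta)=2\Big(\inf_{\nu\in\mathcal G}d_{\mathcal F}(\mu,\nu)+\tau_{\rm opt}+\frac{C_\delta}{\sqrt m}\Big),\quad \varepsilon_{TV}(m,\delta)=\frac{\sqrt{\Gamma_\mu\,\varepsilon_{\mathcal F}(m,\delta)}}{2\sqrt2},$$ and $f(x)=\min(x+\varepsilon_{TV}(m,\delta),1)$ for $0\le x\le1$. **Membership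 inference.** An attack policy is a family, indexed by a real threshold, of randomized decision rules $X\to[0,1]$ (the probability of answering "member"). The attacker sees one test sample and knows $g_\alpha$. A non-member is drawn from $\mu$. A member is drawn uniformly from the training set, whose law given the generator $g$ is the normalized reweighting of $\mu^m$ by the likelihood $\mathbb P(g\mid x_1,\dots,x_m)\propto\exp(-\sum_i\log(\rho_\mu(x_i)/\rho_g(x_i)))$, with a factor of proportionality not depending on the data. The ROC curve is the set of the points (false positive rate, true positive rate) of the policy. **Theorem.** 1. Given the trained generator $g_\alpha$, a member has law $g_\alpha$. 2. With probability at least $1-\delta$ over the training, the ROC curve of every attack policy (which may depend on $g_\alpha$) lies below $f$: every point $(\mathrm{FP},\mathrm{TP})$ on it satisfies $\mathrm{TP}\le f(\mathrm{FP})$. 3. The bound is tight: there are probability distributions $\mu',g'$ on $\mathbb R$ with total variation distance $d_{TV}(\mu',g')=\min(\varepsilon_{TV}(m,\delta),1)$ and a policy whose ROC curve for testing $g'$ (member) against $\mu'$ (non-member) is exactly the graph of $f$ on $[0,1]$. 4. For every $k\ge 1$, $\varepsilon_{TV}(k,\delta)\le\frac12\sqrt{\Gamma_\mu\,(\inf_{\nu\in\mathcal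 G}d_{\mathcal F}(\mu,\nu)+\tau_{\rm opt})}+\frac12\sqrt{\Gamma_\mu C_\delta}\;k^{-1/4}$. If the approximation and optimization errors are negligible, i.e. $\tau_{\rm opt}=\tau_{\rm opt}(k)$ with $\inf_{\nu\in\mathcal G}d_{\mathcal F}(\mu,\nu)+\tau_{\rm opt}(k)=O(k^{-1/2})$, then $\varepsilon_{TV}(k,\delta)=O(k^{-1/4})$ as $k\to\infty$. -/

import Mathlib

open MeasureTheory ProbabilityTheory Filter
open scoped ENNReal

noncomputable section

namespace GanMIA

variable {X : Type*} [MeasurableSpace X]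

/-! ### Discriminators and integral probability metrics -/

/-- The discriminator class is even and uniformly bounded by `Δ`. -/
def IsEvenBounded (F : Set (X → ℝ)) (Δ : ℝ) : Prop :=
  (∀ f ∈ F, -f ∈ F) ∧ ∀ f ∈ F, ∀ x, |f x| ≤ Δ

/-- `F = {f_θ : θ ∈ Θ}` with `Θ ⊆ [-1,1]^p` and
`sup_x |f_θ x - f_θ' x| ≤ L ‖θ - θ'‖` (Euclidean norm of the parameters). -/
def IsLipschitzParametrized (F : Set (X → ℝ)) (p : ℕ) (L : ℝ) : Prop :=
  ∃ (Θ : Set (EuclideanSpace ℝ (Fin p))) (f : EuclideanSpace ℝ (Fin p) → X → ℝ),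
    F = f '' Θ ∧ (∀ θ ∈ Θ, ∀ i, θ i ∈ Set.Icc (-1 : ℝ) 1) ∧
    ∀ θ ∈ Θ, ∀ θ' ∈ Θ, ∀ x, |f θ x - f θ' x| ≤ L * ‖θ - θ'‖

/-- The integral probability metric `d_F(μ, ν) = sup_{f ∈ F} (E_μ f - E_ν f)`. -/
def ipm (F : Set (X → ℝ)) (μ ν : Measure X) : ℝ :=
  ⨆ f : F, ((∫ x, f.1 x ∂μ) - ∫ x, f.1 x ∂ν)

/-- The empirical distribution `(1/m) ∑ δ_{x_i}`. -/
def empirical {m : ℕ} (x : Fin m → X) : Measure X :=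
  (m : ℝ≥0∞)⁻¹ • ∑ i, Measure.dirac (x i)

/-- Total variation distance `sup_S |μ S - ν S|` over measurable sets. -/
def tvDist (μ ν : Measure X) : ℝ :=
  ⨆ S : {S : Set X // MeasurableSet S}, |μ.real S.1 - ν.real S.1|

/-! ### Span and variation norm

Log density ratios are only determined almost everywhere, so the equality between a function and
a linear combination of discriminators is almost sure equality for a measure `κ`. -/

/-- `h = w₀ + ∑ wᵢ fᵢ` with `fᵢ ∈ F`, `κ`-almost everywhere. -/
def IsCombination (F : Set (X → ℝ)) (κ : Measure X) (h : X → ℝ)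
    (n : ℕ) (w₀ : ℝ) (w : Fin n → ℝ) (f : Fin n → X → ℝ) : Prop :=
  (∀ i, f i ∈ F) ∧ h =ᵐ[κ] fun x => w₀ + ∑ i, w i * f i x

/-- `h ∈ span F`, where the span contains the constants. -/
def InSpan (F : Set (X → ℝ)) (κ : Measure X) (h : X → ℝ) : Prop :=
  ∃ n w₀ w f, IsCombination F κ h n w₀ w f

/-- The `F`-variation norm: the infimum of `∑ |wᵢ|` over all representations
`h = w₀ + ∑ wᵢ fᵢ` (it is `∞` if there is none). -/
def variationNorm (F : Set (X → ℝ)) (κ : Measure X) (h : X → ℝ) : ℝ≥0∞ :=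
  sInf {c | ∃ n w₀ w f, IsCombination F κ h n w₀ w f ∧ c = ENNReal.ofReal (∑ i, |w i|)}

/-- `log (ρ_μ / ρ_ν) ∈ span F`. The ratio of the densities is `dμ/dν`; that its logarithm is a
real-valued function means that `μ` and `ν` are mutually absolutely continuous. -/
def LogRatioInSpan (F : Set (X → ℝ)) (μ ν : Measure X) : Prop :=
  μ ≪ ν ∧ ν ≪ μ ∧ InSpan F μ (llr μ ν)

/-- `Γ_μ = sup_{ν ∈ G} ‖log (ρ_μ / ρ_ν)‖_{F,1}`. -/
def complexity (F : Set (X → ℝ)) (G : Set (ProbabilityMeasure X)) (μ : Measure X) : ℝ≥0∞ :=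
  ⨆ ν ∈ G, variationNorm F μ (llr μ (ν : Measure X))

/-! ### The error quantities -/

/-- The approximation error `inf_{ν ∈ G} d_F(μ, ν)`. -/
def approxErr (F : Set (X → ℝ)) (G : Set (ProbabilityMeasure X)) (μ : Measure X) : ℝ :=
  ⨅ ν : G, ipm F μ (ν.1 : Measure X)

/-- `C_ξ = 16 √(2π) p L + 2 Δ √(2 log (1/ξ))`. -/
def genConst (p : ℕ) (L Δ ξ : ℝ) : ℝ :=
  16 * √(2 * Real.pi) * p * L + 2 * Δ * √(2 * Real.log (1 / ξ))

/-- `ε_F(k, ξ) = 2 (inf_{ν ∈ G} d_F(μ, ν) + τ_opt + C_ξ / √k)`. -/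
def epsF (F : Set (X → ℝ)) (G : Set (ProbabilityMeasure X)) (μ : Measure X)
    (p : ℕ) (L Δ τ : ℝ) (k : ℕ) (ξ : ℝ) : ℝ :=
  2 * (approxErr F G μ + τ + genConst p L Δ ξ / √(k : ℝ))

/-- `ε_TV(m, δ) = √(Γ_μ · ε_F(m, δ)) / (2 √2)`. -/
def epsTV (F : Set (X → ℝ)) (G : Set (ProbabilityMeasure X)) (μ : Measure X)
    (p : ℕ) (L Δ τ : ℝ) (m : ℕ) (δ : ℝ) : ℝ :=
  √((complexity F G μ).toReal * epsF F G μ p L Δ τ m δ) / (2 * √2)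

/-! ### Membership inference -/

/-- A (possibly randomized) decision rule for one test sample: `accept x` is the probability with
which the attacker declares `x` to be a training sample. -/
structure Decision (X : Type*) [MeasurableSpace X] where
  accept : X → ℝ
  measurable_accept : Measurable accept
  accept_mem : ∀ x, accept x ∈ Set.Icc (0 : ℝ) 1

/-- An attack policy: one decision rule for each value of a threshold. -/
abbrev AttackPolicy (X : Type*) [MeasurableSpace X] := ℝ → Decision X

/-- The ROC curve of a policy, as the set of all its points (FP, TP), when the test sample has
law `pos` if it is a training sample and law `neg` otherwise. -/
def rocCurve (A : AttackPolicy X) (pos neg : Measure X) : Set (ℝ × ℝ) :=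
  Set.range fun t => (∫ x, (A t).accept x ∂neg, ∫ x, (A t).accept x ∂pos)

/-- The loss of the generator `g` on the sample `x`, `ℓ(g, x) = log (ρ_μ x / ρ_g x)`. -/
def loss (μ g : Measure X) (x : X) : ℝ := llr μ g x

/-- The posterior law of the training set `(x_1, …, x_m)` given that the trained generator is `g`:
the prior law `μ^m` reweighted by the likelihood `ℙ(g | x_1, …, x_m) ∝ exp (-∑ ℓ(g, x_i))`, whose
factor of proportionality does not depend on the data, and normalized. -/
def datasetPosterior (μ g : Measure X) [SigmaFinite μ] (m : ℕ) : Measure (Fin m → X) :=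
  let W : Measure (Fin m → X) := (Measure.pi fun _ => μ).withDensity
    fun x => ENNReal.ofReal (Real.exp (-∑ i, loss μ g (x i)))
  (W Set.univ)⁻¹ • W

/-- The posterior law, given the trained generator `g`, of a sample drawn uniformly from the
training set. -/
def memberLaw (μ g : Measure X) [SigmaFinite μ] (m : ℕ) : Measure X :=
  (m : ℝ≥0∞)⁻¹ • ∑ i, (datasetPosterior μ g m).map fun x => x i

/-- The bounding curve `f(x) = min (x + ε) 1`. -/
def rocBound (ε x : ℝ) : ℝ := min (x + ε) 1

end GanMIA

end

/-!
Given the generator `g`, the likelihood `∏ i, exp (-ℓ(g, x_i))` is the density of `g^m` with respect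
to `μ^m`, so a member is distributed as `g` (`memberLaw_eq`). A test of membership is therefore a
test of `g` against `μ`, and the excess of its true positive rate over its false positive rate is at
most the total variation distance of `μ` and `g`.

That distance is bounded through the symmetrized Kullback-Leibler divergence
`J = E_μ log (ρ_μ / ρ_g) - E_g log (ρ_μ / ρ_g)`. The elementary inequality `tanh u ≤ u` and the
Cauchy-Schwarz inequality, used in its pointwise arithmetic-geometric form, bound the distance by
`√J / 2` (`integral_le_integral_add_of_symm_klDiv_le`). As the log density ratio is a combination of
discriminators, `J ≤ Γ_μ * d_F(μ, g)` (`integral_le_integral_add_of_mem`).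

It remains to show `d_F(μ, g) ≤ inf_ν d_F(μ, ν) + τ + C_δ / √m` with probability at least `1 - δ`.
The triangle inequality reduces this to `2 * d_F(μ, μ̂_m) ≤ C_δ / √m`
(`ipm_le_of_nearly_minimal`). The supremum `d_F(μ, μ̂_m)` changes by at most `2 * Δ / m` when one
sample changes, so McDiarmid's inequality (`hasSubgaussianMGF_of_boundedDifferences`, by induction
on the number of coordinates and Hoeffding's lemma) gives the term of `C_δ` that contains `δ`. The
expected supremum is bounded by chaining over nested dyadic cells of the parameter cube
(`integral_le_of_subgaussian_increments`). The increments of the process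
`θ ↦ E_μ f_θ - E_μ̂ f_θ` are themselves subgaussian by McDiarmid's inequality, with no need for
symmetrization, and the resulting constant `16` is below the required `8 * √(2 * π)`.

The bound is attained by two measures that share an atom of mass `1 - e` and have disjoint atoms of
mass `e = min(ε_TV, 1)` elsewhere (`exists_rocCurve_eq_graph`). The rates follow from the
subadditivity of the square root.
-/

namespace GanMIA

/-! ### Bounded differences -/

/-- A function whose oscillation is at most `c` is subgaussian around its mean (Hoeffding). -/
lemma hasSubgaussianMGF_of_oscillation {X : Type*} [MeasurableSpace X] (μ : Measure X)
    [IsProbabilityMeasure μ] {f : X → ℝ} (hf : Measurable f) {c : NNReal}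
    (hc : ∀ x y, |f x - f y| ≤ c) :
    HasSubgaussianMGF (fun x => f x - ∫ y, f y ∂μ) ((c / 2) ^ 2) μ := by
  obtain ⟨x₀⟩ : Nonempty X := μ.nonempty_of_neZero
  have hbdd : BddBelow (Set.range f) := by
    refine ⟨f x₀ - c, ?_⟩
    rintro _ ⟨y, rfl⟩
    linarith [le_abs_self (f x₀ - f y), hc x₀ y]
  have hmem : ∀ x, f x ∈ Set.Icc (⨅ y, f y) ((⨅ y, f y) + c) := by
    intro x
    have : Nonempty X := ⟨x₀⟩
    refine ⟨ciInf_le hbdd x, ?_⟩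
    have : f x - c ≤ ⨅ y, f y :=
      le_ciInf fun y => by linarith [le_abs_self (f x - f y), hc x y]
    linarith
  have h := hasSubgaussianMGF_of_mem_Icc (μ := μ) hf.aemeasurable (ae_of_all _ hmem)
  simpa using h

/-- McDiarmid's inequality, in the form of a bound on the moment generating function. -/
theorem hasSubgaussianMGF_of_boundedDifferences {X : Type*} [MeasurableSpace X] (μ : Measure X)
    [IsProbabilityMeasure μ] (c : NNReal) :
    ∀ (n : ℕ) (Φ : (Fin n → X) → ℝ) (_ : Measurable Φ) (B : ℝ) (_ : ∀ x, |Φ x| ≤ B)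
      (_ : ∀ x i y, |Φ (Function.update x i y) - Φ x| ≤ c),
      HasSubgaussianMGF (fun x => Φ x - ∫ y, Φ y ∂(Measure.pi fun _ => μ)) (n * (c / 2) ^ 2)
        (Measure.pi fun _ : Fin n => μ) := by
  intro n
  induction n with
  | zero =>
    intro Φ _ B _ _
    have : (fun x => Φ x - ∫ y, Φ y ∂(Measure.pi fun _ : Fin 0 => μ)) = fun _ => 0 := by
      funext x
      have : ∀ y, Φ y = Φ x := fun y => congrArg Φ (Subsingleton.elim _ _)
      simp [this]
    rw [this]
    simp
  | succ n ih =>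
    intro Φ hΦ B hB hd
    set π := Measure.pi fun _ : Fin n => μ
    set Ψ : X → (Fin n → X) → ℝ := fun x y => Φ (Fin.cons x y)
    have hcoe : (fun z : X × (Fin n → X) => (Fin.cons z.1 z.2 : Fin (n + 1) → X))
        = (MeasurableEquiv.piFinSuccAbove (fun _ : Fin (n + 1) => X) 0).symm := by
      funext z
      simp [MeasurableEquiv.piFinSuccAbove, Fin.insertNthEquiv]
    have hcons : Measurable fun z : X × (Fin n → X) => (Fin.cons z.1 z.2 : Fin (n + 1) → X) :=
      hcoe ▸ (MeasurableEquiv.piFinSuccAbove (fun _ : Fin (n + 1) => X) 0).symm.measurable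
    have hΨ : Measurable (Function.uncurry Ψ) := hΦ.comp hcons
    have hmp : MeasurePreserving (fun z : X × (Fin n → X) => (Fin.cons z.1 z.2 : Fin (n + 1) → X))
        (μ.prod π) (Measure.pi fun _ => μ) :=
      hcoe ▸ (measurePreserving_piFinSuccAbove (fun _ : Fin (n + 1) => μ) 0).symm
    have hint : ∀ h : (Fin (n + 1) → X) → ℝ, Measurable h →
        ∫ z, h z ∂(Measure.pi fun _ => μ) = ∫ z, h (Fin.cons z.1 z.2) ∂(μ.prod π) := by
      intro h hh
      rw [← hmp.map_eq, integral_map hmp.measurable.aemeasurable hh.aestronglyMeasurable]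
    have hΨint : Integrable (Function.uncurry Ψ) (μ.prod π) :=
      Integrable.of_bound hΨ.aestronglyMeasurable B (ae_of_all _ fun z => hB _)
    -- `Φ - E = (Φ - g) + (g - E)`: the first part depends on one coordinate, given the others, and
    -- has oscillation `c`; the second is a function of `n` coordinates with bounded differences
    set g : (Fin n → X) → ℝ := fun y => ∫ x, Ψ x y ∂μ
    have hΨy : ∀ y, Measurable fun x => Ψ x y := fun y =>
      hΨ.comp (measurable_id.prodMk measurable_const)
    have hΨyint : ∀ y, Integrable (fun x => Ψ x y) μ := fun y =>
      Integrable.of_bound (hΨy y).aestronglyMeasurable B (ae_of_all _ fun z => hB _)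
    have hg : Measurable g :=
      (StronglyMeasurable.integral_prod_left (f := Ψ) hΨ.stronglyMeasurable).measurable
    have hgB : ∀ y, |g y| ≤ B := fun y => by
      have := norm_integral_le_of_norm_le_const (μ := μ) (f := fun x => Ψ x y)
        (ae_of_all _ fun x => hB _)
      simpa using this
    have hgd : ∀ y i z, |g (Function.update y i z) - g y| ≤ c := fun y i z => by
      have h1 : g (Function.update y i z) - g y = ∫ x, (Ψ x (Function.update y i z) - Ψ x y) ∂μ :=
        (integral_sub (hΨyint _) (hΨyint _)).symm
      rw [h1]
      have := norm_integral_le_of_norm_le_const (μ := μ) (C := (c : ℝ))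
        (f := fun x => Ψ x (Function.update y i z) - Ψ x y) (ae_of_all _ fun x => by
          have := hd (Fin.cons x y) i.succ z
          rwa [← Fin.cons_update] at this)
      simpa using this
    have hE : ∫ y, Φ y ∂(Measure.pi fun _ => μ) = ∫ y, g y ∂π := by
      rw [hint Φ hΦ]
      exact integral_prod_symm _ hΨint
    have hIH := ih g hg B hgB hgd
    set E := ∫ y, g y ∂π
    have hosc : ∀ y, HasSubgaussianMGF (fun x => Ψ x y - g y) ((c / 2) ^ 2) μ := fun y =>
      hasSubgaussianMGF_of_oscillation μ (hΨy y) fun x x' => by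
        have := hd (Fin.cons x' y) 0 x
        rwa [Fin.update_cons_zero] at this
    rw [hE]
    have hbound : ∀ t : ℝ, ∀ x, Real.exp (t * (Φ x - E)) ≤ Real.exp (|t| * (B + |E|)) := by
      intro t x
      apply Real.exp_le_exp.2
      calc t * (Φ x - E) ≤ |t * (Φ x - E)| := le_abs_self _
        _ = |t| * |Φ x - E| := abs_mul _ _
        _ ≤ |t| * (B + |E|) := by
          gcongr
          exact (abs_sub _ _).trans (by gcongr; exact hB x)
    have hmeas : ∀ t : ℝ, Measurable fun x => Real.exp (t * (Φ x - E)) := fun t => by fun_prop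
    have hintexp : ∀ t : ℝ, Integrable (fun x => Real.exp (t * (Φ x - E)))
        (Measure.pi fun _ => μ) := fun t =>
      Integrable.of_bound (hmeas t).aestronglyMeasurable (Real.exp (|t| * (B + |E|)))
        (ae_of_all _ fun x => by rw [Real.norm_eq_abs, Real.abs_exp]; exact hbound t x)
    refine ⟨hintexp, fun t => ?_⟩
    have h1 : mgf (fun x => Φ x - E) (Measure.pi fun _ => μ) t
        = ∫ y, ∫ x, Real.exp (t * (Ψ x y - E)) ∂μ ∂π := by
      rw [mgf, hint _ (hmeas t)]
      exact integral_prod_symm _ (hmp.integrable_comp_of_integrable (hintexp t))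
    have h2 : ∀ y, ∫ x, Real.exp (t * (Ψ x y - E)) ∂μ
        ≤ Real.exp (((c / 2) ^ 2 : NNReal) * t ^ 2 / 2) * Real.exp (t * (g y - E)) := by
      intro y
      have : ∀ x, Real.exp (t * (Ψ x y - E))
          = Real.exp (t * (Ψ x y - g y)) * Real.exp (t * (g y - E)) := fun x => by
        rw [← Real.exp_add]; ring_nf
      simp_rw [this]
      rw [integral_mul_const]
      gcongr
      exact (hosc y).mgf_le t
    rw [h1]
    calc ∫ y, ∫ x, Real.exp (t * (Ψ x y - E)) ∂μ ∂π
        ≤ ∫ y, Real.exp (((c / 2) ^ 2 : NNReal) * t ^ 2 / 2) * Real.exp (t * (g y - E)) ∂π := by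
          refine integral_mono ?_ ((hIH.integrable_exp_mul t).const_mul _) h2
          exact (hmp.integrable_comp_of_integrable (hintexp t)).integral_prod_right
      _ = Real.exp (((c / 2) ^ 2 : NNReal) * t ^ 2 / 2) * mgf (fun y => g y - E) π t := by
          rw [integral_const_mul]; rfl
      _ ≤ Real.exp (((c / 2) ^ 2 : NNReal) * t ^ 2 / 2)
          * Real.exp ((n * (c / 2) ^ 2 : NNReal) * t ^ 2 / 2) := by
          gcongr
          exact hIH.mgf_le t
      _ = _ := by
          rw [← Real.exp_add]
          push_cast
          ring_nf

/-! ### Chaining over dyadic cells -/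

/-- The integrable majorant of the maximum of finitely many variables used in a chaining step: it
comes from the tangent line bound `x ≤ a - 1 + exp (x - a)` at `x = l * W i ω`. -/
noncomputable def maxMajorant {Ω ι : Type*} [Fintype ι] (l a : ℝ) (W : ι → Ω → ℝ) (ω : Ω) : ℝ :=
  (a - 1 + Real.exp (-a) * ∑ i, Real.exp (l * W i ω)) / l

lemma le_maxMajorant {Ω ι : Type*} [Fintype ι] {l : ℝ} (hl : 0 < l) (a : ℝ) (W : ι → Ω → ℝ)
    (i : ι) (ω : Ω) : W i ω ≤ maxMajorant l a W ω := by
  rw [maxMajorant, le_div_iff₀ hl]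
  have h1 := Real.add_one_le_exp (l * W i ω - a)
  have h2 : Real.exp (l * W i ω - a) ≤ Real.exp (-a) * ∑ i, Real.exp (l * W i ω) := by
    rw [sub_eq_neg_add, Real.exp_add]
    gcongr
    exact Finset.single_le_sum (f := fun i => Real.exp (l * W i ω))
      (fun _ _ => (Real.exp_pos _).le) (Finset.mem_univ i)
  linarith

lemma integrable_maxMajorant {Ω ι : Type*} [Fintype ι] [MeasurableSpace Ω] {P : Measure Ω}
    [IsProbabilityMeasure P] (l a : ℝ) {W : ι → Ω → ℝ} {s : NNReal}
    (hW : ∀ i, HasSubgaussianMGF (W i) s P) : Integrable (maxMajorant l a W) P := by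
  refine Integrable.div_const (Integrable.add (integrable_const _) (Integrable.const_mul ?_ _)) _
  exact integrable_finsetSum _ fun i _ => (hW i).integrable_exp_mul l

/-- With the right choice of the tangency point, the majorant of the maximum of `exp q` variables
which are subgaussian with variance proxy `s` has expectation at most `q / l + l * s / 2`. -/
lemma integral_maxMajorant_le {Ω ι : Type*} [Fintype ι] [MeasurableSpace Ω] {P : Measure Ω}
    [IsProbabilityMeasure P] {l : ℝ} (hl : 0 < l) {W : ι → Ω → ℝ} {s : NNReal}
    (hW : ∀ i, HasSubgaussianMGF (W i) s P) {q : ℝ} (hq : (Fintype.card ι : ℝ) ≤ Real.exp q) :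
    ∫ ω, maxMajorant l (q + s * l ^ 2 / 2) W ω ∂P ≤ q / l + l * s / 2 := by
  have hi : ∀ i, Integrable (fun ω => Real.exp (l * W i ω)) P := fun i =>
    (hW i).integrable_exp_mul l
  have hs : ∑ i, ∫ ω, Real.exp (l * W i ω) ∂P ≤ Real.exp (q + s * l ^ 2 / 2) := by
    calc ∑ i, ∫ ω, Real.exp (l * W i ω) ∂P
        ≤ ∑ _i : ι, Real.exp (s * l ^ 2 / 2) := Finset.sum_le_sum fun i _ => (hW i).mgf_le l
      _ = Fintype.card ι * Real.exp (s * l ^ 2 / 2) := by simp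
      _ ≤ Real.exp q * Real.exp (s * l ^ 2 / 2) := by gcongr
      _ = _ := (Real.exp_add _ _).symm
  simp only [maxMajorant]
  rw [integral_div, integral_add (integrable_const _)
    ((integrable_finsetSum _ fun i _ => hi i).const_mul _), integral_const_mul,
    integral_finsetSum _ fun i _ => hi i, integral_const]
  have h2 : Real.exp (-(q + s * l ^ 2 / 2)) * ∑ i, ∫ ω, Real.exp (l * W i ω) ∂P ≤ 1 := by
    calc _ ≤ Real.exp (-(q + s * l ^ 2 / 2)) * Real.exp (q + s * l ^ 2 / 2) := by gcongr
      _ = 1 := by rw [← Real.exp_add]; simp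
  rw [div_le_iff₀ hl]
  have : (q / l + l * s / 2) * l = q + s * l ^ 2 / 2 := by field_simp
  rw [this]
  simp only [probReal_univ, smul_eq_mul, one_mul]
  linarith

/-- The dyadic cell of generation `j` that contains a point of the cube `[-1, 1]^p`; the cube is
embedded in `[0, 1/2]^p`, so that the `2 ^ j` subintervals `[i / 2 ^ j, (i + 1) / 2 ^ j)` of each
axis suffice. The remainder modulo `2 ^ j` has no effect on points of the cube. -/
noncomputable def dyadicCell {p : ℕ} (j : ℕ) (θ : EuclideanSpace ℝ (Fin p)) :
    Fin p → Fin (2 ^ j) := fun i =>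
  ⟨⌊(θ i + 1) / 4 * 2 ^ j⌋₊ % 2 ^ j, Nat.mod_lt _ (by positivity)⟩

lemma dyadicCell_val {p : ℕ} {θ : EuclideanSpace ℝ (Fin p)}
    (hθ : ∀ i, θ i ∈ Set.Icc (-1 : ℝ) 1) (j : ℕ) (i : Fin p) :
    (dyadicCell j θ i : ℕ) = ⌊(θ i + 1) / 4 * 2 ^ j⌋₊ := by
  apply Nat.mod_eq_of_lt
  obtain ⟨h1, h2⟩ := hθ i
  rw [Nat.floor_lt (mul_nonneg (by linarith) (by positivity))]
  push_cast
  have : (0 : ℝ) < 2 ^ j := by positivity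
  nlinarith

/-- Dyadic cells are nested. -/
lemma dyadicCell_eq_of_succ {p : ℕ} {θ θ' : EuclideanSpace ℝ (Fin p)}
    (hθ : ∀ i, θ i ∈ Set.Icc (-1 : ℝ) 1) (hθ' : ∀ i, θ' i ∈ Set.Icc (-1 : ℝ) 1) {j : ℕ}
    (h : dyadicCell (j + 1) θ = dyadicCell (j + 1) θ') : dyadicCell j θ = dyadicCell j θ' := by
  have key : ∀ {x : EuclideanSpace ℝ (Fin p)} (_ : ∀ i, x i ∈ Set.Icc (-1 : ℝ) 1) (i : Fin p),
      (dyadicCell j x i : ℕ) = (dyadicCell (j + 1) x i : ℕ) / 2 := by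
    intro x hx i
    rw [dyadicCell_val hx, dyadicCell_val hx, ← Nat.floor_div_natCast]
    congr 1
    push_cast
    ring
  funext i
  apply Fin.ext
  rw [key hθ, key hθ', h]

/-- A dyadic cell of generation `j` has diameter at most `4 * √p * 2 ^ (-j)`. -/
lemma norm_sub_le_of_dyadicCell_eq {p : ℕ} {θ θ' : EuclideanSpace ℝ (Fin p)}
    (hθ : ∀ i, θ i ∈ Set.Icc (-1 : ℝ) 1) (hθ' : ∀ i, θ' i ∈ Set.Icc (-1 : ℝ) 1) {j : ℕ}
    (h : dyadicCell j θ = dyadicCell j θ') : ‖θ - θ'‖ ≤ √p * (4 / 2 ^ j) := by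
  have hj : (0 : ℝ) < 2 ^ j := by positivity
  have hi : ∀ i, |θ i - θ' i| ≤ 4 / 2 ^ j := by
    intro i
    have e : ⌊(θ i + 1) / 4 * 2 ^ j⌋₊ = ⌊(θ' i + 1) / 4 * 2 ^ j⌋₊ := by
      rw [← dyadicCell_val hθ, ← dyadicCell_val hθ', h]
    have n1 : 0 ≤ (θ i + 1) / 4 * 2 ^ j := mul_nonneg (by linarith [(hθ i).1]) hj.le
    have n2 : 0 ≤ (θ' i + 1) / 4 * 2 ^ j := mul_nonneg (by linarith [(hθ' i).1]) hj.le
    have a1 := Nat.floor_le n1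
    have a2 := Nat.lt_floor_add_one ((θ i + 1) / 4 * 2 ^ j)
    have b1 := Nat.floor_le n2
    have b2 := Nat.lt_floor_add_one ((θ' i + 1) / 4 * 2 ^ j)
    rw [e] at a1 a2
    have habs : |θ i - θ' i| * 2 ^ j = |(θ i - θ' i) * 2 ^ j| := by rw [abs_mul, abs_of_pos hj]
    rw [le_div_iff₀ hj, habs, abs_le]
    constructor <;> nlinarith
  rw [EuclideanSpace.norm_eq]
  calc √(∑ i, ‖(θ - θ') i‖ ^ 2) ≤ √(∑ _i : Fin p, (4 / 2 ^ j : ℝ) ^ 2) := by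
        gcongr with i
        simpa using hi i
    _ = √p * (4 / 2 ^ j) := by
        rw [Finset.sum_const, Finset.card_univ, Fintype.card_fin, nsmul_eq_mul,
          Real.sqrt_mul (Nat.cast_nonneg _), Real.sqrt_sq (by positivity)]

lemma sum_chaining_weights_le (J : ℕ) :
    ∑ j ∈ Finset.range J, (2 * (0.7 * (j + 1)) + 4) / (2 : ℝ) ^ j ≤ 16 := by
  have h : ∀ J : ℕ, ∑ j ∈ Finset.range J, (2 * (0.7 * (j + 1)) + 4) / (2 : ℝ) ^ j
      = 13.6 - (2.8 * J + 13.6) / (2 : ℝ) ^ J := by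
    intro J
    induction J with
    | zero => norm_num
    | succ J ih =>
      rw [Finset.sum_range_succ, ih]
      push_cast
      field_simp
      ring
  rw [h]
  have : 0 ≤ (2.8 * J + 13.6) / (2 : ℝ) ^ J := by positivity
  linarith

/-- Chaining: the expected supremum of a centered process over a subset of `[-1, 1]^p` whose
increments are subgaussian for `K` times the Euclidean distance is at most `16 * p * K`. The
supremum enters through an integrable function `Φ` bounded by it. -/
theorem integral_le_of_subgaussian_increments {Ω T : Type*} [MeasurableSpace Ω] [Nonempty T]
    {P : Measure Ω} [IsProbabilityMeasure P] {p : ℕ} (θ : T → EuclideanSpace ℝ (Fin p))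
    (hθ : ∀ t i, θ t i ∈ Set.Icc (-1 : ℝ) 1) {K B : ℝ} (hK : 0 < K) (Z : T → Ω → ℝ)
    (hZint : ∀ t, Integrable (Z t) P) (hZ0 : ∀ t, ∫ ω, Z t ω ∂P = 0)
    (hsub : ∀ s t, HasSubgaussianMGF (fun ω => Z s ω - Z t ω)
      (Real.toNNReal (K * ‖θ s - θ t‖) ^ 2) P)
    (hB : 0 ≤ B) (hlip : ∀ s t ω, Z s ω - Z t ω ≤ B * ‖θ s - θ t‖)
    (Φ : Ω → ℝ) (hΦ : Integrable Φ P) (hΦle : ∀ ω b, (∀ t, Z t ω ≤ b) → Φ ω ≤ b) :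
    ∫ ω, Φ ω ∂P ≤ 16 * p * K := by
  classical
  rcases Nat.eq_zero_or_pos p with rfl | hp
  · -- all parameters coincide, so the process is constant in `t`
    obtain ⟨t₀⟩ := ‹Nonempty T›
    have : ∀ ω, Φ ω ≤ Z t₀ ω := fun ω => hΦle ω _ fun t => by
      have h := hlip t t₀ ω
      rw [Subsingleton.elim (θ t) (θ t₀), sub_self, norm_zero, mul_zero] at h
      linarith
    have := integral_mono hΦ (hZint t₀) this
    rw [hZ0] at this
    simpa using this
  set cell : (j : ℕ) → T → (Fin p → Fin (2 ^ j)) := fun j t => dyadicCell j (θ t)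
  -- the representative of a cell; the chain of `t` consists of the representatives of its cells
  set sel : (j : ℕ) → (Fin p → Fin (2 ^ j)) → T := fun j => Function.invFun (cell j)
  have hsel : ∀ j t, cell j (sel j (cell j t)) = cell j t := fun j t =>
    Function.invFun_eq ⟨t, rfl⟩
  -- the increment of the chain that ends at the cell `c` of generation `j + 1`; cells being nested,
  -- the preceding link is determined by `c`
  set W : (j : ℕ) → (Fin p → Fin (2 ^ (j + 1))) → Ω → ℝ := fun j c ω =>
    Z (sel (j + 1) c) ω - Z (sel j (cell j (sel (j + 1) c))) ω
  set s : ℕ → NNReal := fun j => Real.toNNReal (K * (√p * (4 / 2 ^ j))) ^ 2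
  have hdist : ∀ j t, ‖θ t - θ (sel j (cell j t))‖ ≤ √p * (4 / 2 ^ j) := fun j t =>
    norm_sub_le_of_dyadicCell_eq (hθ _) (hθ _) (hsel j t).symm
  have hWsub : ∀ j c, HasSubgaussianMGF (W j c) (s j) P := by
    intro j c
    have h := hsub (sel (j + 1) c) (sel j (cell j (sel (j + 1) c)))
    refine ⟨h.integrable_exp_mul, fun t => (h.mgf_le t).trans ?_⟩
    have hle : Real.toNNReal (K * ‖θ (sel (j + 1) c) - θ (sel j (cell j (sel (j + 1) c)))‖) ^ 2
        ≤ s j := by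
      simp only [s]
      gcongr
      exact hdist j _
    gcongr
  -- the parameters of the exponential moments, inverse to the scale of generation `j`
  set l : ℕ → ℝ := fun j => 2 ^ j / (2 * K)
  have hl : ∀ j, 0 < l j := fun j => by positivity
  set q : ℕ → ℝ := fun j => p * (0.7 * (j + 1))
  have hq : ∀ j, (Fintype.card (Fin p → Fin (2 ^ (j + 1))) : ℝ) ≤ Real.exp (q j) := by
    intro j
    -- `log 2 ≤ 0.7`, the constant in `q`
    have h2 : (2 : ℝ) ≤ Real.exp 0.7 := by
      rw [← Real.log_le_iff_le_exp (by norm_num)]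
      linarith [Real.log_two_lt_d9]
    simp only [Fintype.card_fun, Fintype.card_fin, Nat.cast_pow, Nat.cast_ofNat, q]
    rw [← pow_mul]
    calc (2 : ℝ) ^ ((j + 1) * p) ≤ Real.exp 0.7 ^ ((j + 1) * p) := by gcongr
      _ = Real.exp (p * (0.7 * (j + 1))) := by
        rw [← Real.exp_nat_mul]
        push_cast
        ring_nf
  set M : ℕ → Ω → ℝ := fun j => maxMajorant (l j) (q j + s j * l j ^ 2 / 2) (W j)
  have hMint : ∀ j, Integrable (M j) P := fun j => integrable_maxMajorant _ _ (hWsub j)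
  have hMle : ∀ j, ∫ ω, M j ω ∂P ≤ p * K * ((2 * (0.7 * (j + 1)) + 4) / 2 ^ j) := by
    intro j
    refine (integral_maxMajorant_le (hl j) (hWsub j) (hq j)).trans (le_of_eq ?_)
    have hs : (s j : ℝ) = K ^ 2 * (p * (4 / 2 ^ j) ^ 2) := by
      simp only [s, NNReal.coe_pow]
      rw [Real.coe_toNNReal _ (by positivity), mul_pow, mul_pow, Real.sq_sqrt (by positivity)]
    rw [hs]
    simp only [l, q]
    field_simp
    ring
  -- there is a single cell of generation `0`, so all chains start at the same point
  set t₀ : T := sel 0 (cell 0 (Classical.arbitrary T))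
  have hbase : ∀ t, sel 0 (cell 0 t) = t₀ := fun t => by
    have : ∀ c c' : Fin p → Fin (2 ^ 0), c = c' := fun c c' => by
      funext i
      apply Fin.ext
      have h1 := (c i).2
      have h2 := (c' i).2
      simp only [pow_zero] at h1 h2
      omega
    simp only [t₀]
    rw [this (cell 0 t)]
  have hstep : ∀ j t ω, Z (sel (j + 1) (cell (j + 1) t)) ω - Z (sel j (cell j t)) ω ≤ M j ω := by
    intro j t ω
    have h := le_maxMajorant (hl j) (q j + s j * l j ^ 2 / 2) (W j) (cell (j + 1) t) ω
    have e : cell j (sel (j + 1) (cell (j + 1) t)) = cell j t :=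
      dyadicCell_eq_of_succ (hθ _) (hθ _) (hsel (j + 1) t)
    simp only [W] at h
    rwa [e] at h
  have htel : ∀ J t ω, Z (sel J (cell J t)) ω ≤ Z t₀ ω + ∑ j ∈ Finset.range J, M j ω := by
    intro J t ω
    induction J with
    | zero => simp [hbase]
    | succ J ih =>
      rw [Finset.sum_range_succ]
      linarith [hstep J t ω]
  have hJ : ∀ J : ℕ, ∫ ω, Φ ω ∂P ≤ 16 * p * K + B * (√p * 4) * (1 / 2) ^ J := by
    intro J
    have hpt : ∀ ω, Φ ω ≤ Z t₀ ω + ∑ j ∈ Finset.range J, M j ω + B * (√p * 4) * (1 / 2) ^ J := by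
      intro ω
      refine hΦle ω _ fun t => ?_
      have h1 := htel J t ω
      have h2 := hlip t (sel J (cell J t)) ω
      have h3 : B * ‖θ t - θ (sel J (cell J t))‖ ≤ B * (√p * (4 / 2 ^ J)) := by
        gcongr
        exact hdist J t
      have h4 : B * (√p * (4 / 2 ^ J)) = B * (√p * 4) * (1 / 2) ^ J := by
        rw [div_pow, one_pow]; ring
      linarith
    have hsum : Integrable (fun ω => ∑ j ∈ Finset.range J, M j ω) P :=
      integrable_finsetSum _ fun j _ => hMint j
    have hsum' : Integrable (fun ω => Z t₀ ω + ∑ j ∈ Finset.range J, M j ω) P :=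
      (hZint t₀).add hsum
    have hmono := integral_mono hΦ (hsum'.add (integrable_const _)) hpt
    refine hmono.trans ?_
    have e : ∫ ω, (Z t₀ ω + ∑ j ∈ Finset.range J, M j ω + B * (√p * 4) * (1 / 2) ^ J) ∂P
        = ∑ j ∈ Finset.range J, ∫ ω, M j ω ∂P + B * (√p * 4) * (1 / 2) ^ J := by
      rw [integral_add hsum' (integrable_const _), integral_add (hZint t₀) hsum,
        hZ0, integral_finsetSum _ fun j _ => hMint j]
      simp
    refine e.le.trans ?_
    gcongr
    calc ∑ j ∈ Finset.range J, ∫ ω, M j ω ∂P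
        ≤ ∑ j ∈ Finset.range J, p * K * ((2 * (0.7 * (j + 1)) + 4) / (2 : ℝ) ^ j) :=
          Finset.sum_le_sum fun j _ => hMle j
      _ = p * K * ∑ j ∈ Finset.range J, (2 * (0.7 * (j + 1)) + 4) / (2 : ℝ) ^ j := by
          rw [Finset.mul_sum]
      _ ≤ p * K * 16 := by
          gcongr
          exact sum_chaining_weights_le J
      _ = 16 * p * K := by ring
  have hlim : Tendsto (fun J : ℕ => 16 * p * K + B * (√p * 4) * (1 / 2 : ℝ) ^ J) atTop
      (nhds (16 * p * K + B * (√p * 4) * 0)) :=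
    ((tendsto_pow_atTop_nhds_zero_of_lt_one (by norm_num) (by norm_num)).const_mul _).const_add _
  rw [mul_zero, add_zero] at hlim
  exact ge_of_tendsto' hlim hJ

/-! ### Integral probability metrics -/

section IPM

variable {X : Type*} [MeasurableSpace X] {F : Set (X → ℝ)} {Δ : ℝ}

lemma IsEvenBounded.integrable (hF : IsEvenBounded F Δ) (hFm : ∀ f ∈ F, Measurable f)
    (μ : Measure X) [IsFiniteMeasure μ] {f : X → ℝ} (hf : f ∈ F) : Integrable f μ :=
  Integrable.of_bound (hFm f hf).aestronglyMeasurable Δ (ae_of_all _ (hF.2 f hf))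

lemma IsEvenBounded.abs_integral_le (hF : IsEvenBounded F Δ) (μ : Measure X)
    [IsProbabilityMeasure μ] {f : X → ℝ} (hf : f ∈ F) : |∫ x, f x ∂μ| ≤ Δ := by
  have := norm_integral_le_of_norm_le_const (μ := μ) (f := f) (ae_of_all _ (hF.2 f hf))
  simpa using this

lemma integral_sub_le_ipm (hF : IsEvenBounded F Δ) (μ ν : Measure X) [IsProbabilityMeasure μ]
    [IsProbabilityMeasure ν] {f : X → ℝ} (hf : f ∈ F) :
    ∫ x, f x ∂μ - ∫ x, f x ∂ν ≤ ipm F μ ν := by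
  refine le_ciSup (f := fun f : F => (∫ x, f.1 x ∂μ) - ∫ x, f.1 x ∂ν) ⟨2 * Δ, ?_⟩ ⟨f, hf⟩
  rintro _ ⟨f, rfl⟩
  have h1 := abs_le.1 (hF.abs_integral_le μ f.2)
  have h2 := abs_le.1 (hF.abs_integral_le ν f.2)
  simp only
  linarith

lemma abs_integral_sub_le_ipm (hF : IsEvenBounded F Δ) (μ ν : Measure X) [IsProbabilityMeasure μ]
    [IsProbabilityMeasure ν] {f : X → ℝ} (hf : f ∈ F) :
    |∫ x, f x ∂μ - ∫ x, f x ∂ν| ≤ ipm F μ ν := by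
  have h1 := integral_sub_le_ipm hF μ ν hf
  have h2 := integral_sub_le_ipm hF μ ν (hF.1 f hf)
  simp only [Pi.neg_apply, integral_neg] at h2
  rw [abs_le]
  constructor <;> linarith

lemma ipm_le (hFne : F.Nonempty) (μ ν : Measure X) {b : ℝ}
    (h : ∀ f ∈ F, ∫ x, f x ∂μ - ∫ x, f x ∂ν ≤ b) : ipm F μ ν ≤ b := by
  have : Nonempty F := hFne.to_subtype
  exact ciSup_le fun f => h f f.2

lemma ipm_nonneg (hFne : F.Nonempty) (hF : IsEvenBounded F Δ) (μ ν : Measure X)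
    [IsProbabilityMeasure μ] [IsProbabilityMeasure ν] : 0 ≤ ipm F μ ν := by
  obtain ⟨f, hf⟩ := hFne
  exact (abs_nonneg _).trans (abs_integral_sub_le_ipm hF μ ν hf)

lemma ipm_comm_le (hFne : F.Nonempty) (hF : IsEvenBounded F Δ) (μ ν : Measure X)
    [IsProbabilityMeasure μ] [IsProbabilityMeasure ν] : ipm F ν μ ≤ ipm F μ ν :=
  ipm_le hFne _ _ fun f hf => by
    have := abs_le.1 (abs_integral_sub_le_ipm hF μ ν hf)
    linarith

lemma ipm_triangle (hFne : F.Nonempty) (hF : IsEvenBounded F Δ) (μ ν κ : Measure X)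
    [IsProbabilityMeasure μ] [IsProbabilityMeasure ν] [IsProbabilityMeasure κ] :
    ipm F μ κ ≤ ipm F μ ν + ipm F ν κ :=
  ipm_le hFne _ _ fun f hf => by
    have h1 := integral_sub_le_ipm hF μ ν hf
    have h2 := integral_sub_le_ipm hF ν κ hf
    linarith

lemma isProbabilityMeasure_empirical {m : ℕ} (hm : 0 < m) (x : Fin m → X) :
    IsProbabilityMeasure (empirical x) := by
  constructor
  simp only [empirical, Measure.smul_apply, Measure.finsetSum_apply, measure_univ, smul_eq_mul,
    Finset.sum_const, Finset.card_univ, Fintype.card_fin, nsmul_eq_mul, mul_one]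
  exact ENNReal.inv_mul_cancel (by exact_mod_cast hm.ne') (ENNReal.natCast_ne_top m)

lemma integral_empirical {m : ℕ} (x : Fin m → X) {f : X → ℝ} (hf : Measurable f) :
    ∫ y, f y ∂(empirical x) = (∑ i, f (x i)) / m := by
  rw [empirical, integral_smul_measure, integral_finsetSum_measure]
  · simp [integral_dirac' _ _ hf.stronglyMeasurable, div_eq_inv_mul]
  · intro i _
    exact (integrable_dirac' hf.stronglyMeasurable (by simp))

/-- Excess risk decomposition: a minimizer, up to `τ`, of the distance to an approximation `κ` of
`μ` minimizes the distance to `μ` up to `τ` and twice the distance of `κ` and `μ`. -/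
lemma ipm_le_of_nearly_minimal (hFne : F.Nonempty) (hF : IsEvenBounded F Δ)
    (G : Set (ProbabilityMeasure X)) (μ κ : Measure X) [IsProbabilityMeasure μ]
    [IsProbabilityMeasure κ] {g : ProbabilityMeasure X} (hg : g ∈ G) {τ : ℝ}
    (hopt : ipm F κ (g : Measure X) - (⨅ ν : G, ipm F κ (ν.1 : Measure X)) ≤ τ) :
    ipm F μ (g : Measure X) ≤ approxErr F G μ + τ + 2 * ipm F μ κ := by
  have : Nonempty G := ⟨⟨g, hg⟩⟩
  have h1 : (⨅ ν : G, ipm F κ (ν.1 : Measure X)) - ipm F μ κ ≤ approxErr F G μ := by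
    refine le_ciInf fun ν => ?_
    have h2 : (⨅ ν : G, ipm F κ (ν.1 : Measure X)) ≤ ipm F κ (ν.1 : Measure X) :=
      ciInf_le ⟨0, by rintro _ ⟨ν, rfl⟩; exact ipm_nonneg hFne hF _ _⟩ ν
    have h3 := ipm_triangle hFne hF κ μ (ν.1 : Measure X)
    have h4 := ipm_comm_le hFne hF μ κ
    linarith
  have h5 := ipm_triangle hFne hF μ κ (g : Measure X)
  linarith

end IPM

/-! ### Uniform deviations of the empirical distribution -/

lemma abs_sum_div_le {m : ℕ} (hm : 0 < m) {a : Fin m → ℝ} {C : ℝ} (h : ∀ i, |a i| ≤ C) :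
    |(∑ i, a i) / m| ≤ C := by
  have hm' : (0 : ℝ) < m := by exact_mod_cast hm
  rw [abs_div, abs_of_pos hm', div_le_iff₀ hm']
  calc |∑ i, a i| ≤ ∑ i, |a i| := Finset.abs_sum_le_sum_abs _ _
    _ ≤ ∑ _i : Fin m, C := Finset.sum_le_sum fun i _ => h i
    _ = C * m := by simp [mul_comm]

section Empirical

variable {X : Type*} [MeasurableSpace X] (μ : Measure X)

/-- The deviation of the expectation of `f` from its empirical mean, as a function of the
sample. -/
noncomputable def meanDeviation (m : ℕ) (f : X → ℝ) (x : Fin m → X) : ℝ :=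
  ∫ y, f y ∂μ - (∑ i, f (x i)) / m

lemma measurable_meanDeviation (m : ℕ) {f : X → ℝ} (hf : Measurable f) :
    Measurable (meanDeviation μ m f) := by
  unfold meanDeviation
  fun_prop

lemma meanDeviation_sub {m : ℕ} {f g : X → ℝ} (hf : Integrable f μ) (hg : Integrable g μ)
    (x : Fin m → X) :
    meanDeviation μ m (fun y => f y - g y) x = meanDeviation μ m f x - meanDeviation μ m g x := by
  simp only [meanDeviation]
  rw [integral_sub hf hg, Finset.sum_sub_distrib]
  ring

lemma abs_meanDeviation_update_sub_le {m : ℕ} {f : X → ℝ} {c : ℝ} (h : ∀ y z, |f y - f z| ≤ c)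
    (x : Fin m → X) (i : Fin m) (y : X) :
    |meanDeviation μ m f (Function.update x i y) - meanDeviation μ m f x| ≤ c / m := by
  classical
  have hs : ∑ j, f (Function.update x i y j) = f y + ∑ j ∈ Finset.univ.erase i, f (x j) := by
    rw [← Finset.add_sum_erase _ _ (Finset.mem_univ i), Function.update_self]
    congr 1
    exact Finset.sum_congr rfl fun j hj => by
      rw [Function.update_of_ne (Finset.ne_of_mem_erase hj)]
  have hs' : ∑ j, f (x j) = f (x i) + ∑ j ∈ Finset.univ.erase i, f (x j) :=
    (Finset.add_sum_erase _ _ (Finset.mem_univ i)).symm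
  have : meanDeviation μ m f (Function.update x i y) - meanDeviation μ m f x
      = (f (x i) - f y) / m := by
    simp only [meanDeviation]
    rw [hs, hs']
    ring
  rw [this, abs_div, Nat.abs_cast]
  gcongr
  exact h _ _

variable [IsProbabilityMeasure μ]

lemma abs_meanDeviation_le {m : ℕ} (hm : 0 < m) {f : X → ℝ} {C : ℝ} (h : ∀ y, |f y| ≤ C)
    (x : Fin m → X) : |meanDeviation μ m f x| ≤ 2 * C := by
  have h1 := abs_sum_div_le hm (a := fun i => f (x i)) fun i => h (x i)
  have h2 := norm_integral_le_of_norm_le_const (μ := μ) (f := f) (ae_of_all _ h)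
  simp only [Real.norm_eq_abs, probReal_univ, mul_one] at h2
  calc _ ≤ |∫ y, f y ∂μ| + |(∑ i, f (x i)) / m| := abs_sub _ _
    _ ≤ 2 * C := by linarith

lemma integrable_meanDeviation {m : ℕ} (hm : 0 < m) {f : X → ℝ} (hf : Measurable f) {C : ℝ}
    (h : ∀ y, |f y| ≤ C) :
    Integrable (meanDeviation μ m f) (Measure.pi fun _ : Fin m => μ) :=
  Integrable.of_bound (measurable_meanDeviation μ m hf).aestronglyMeasurable (2 * C)
    (ae_of_all _ (abs_meanDeviation_le μ hm h))

lemma integral_meanDeviation {m : ℕ} (hm : 0 < m) {f : X → ℝ} (hf : Measurable f) {C : ℝ}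
    (h : ∀ y, |f y| ≤ C) :
    ∫ x, meanDeviation μ m f x ∂(Measure.pi fun _ : Fin m => μ) = 0 := by
  have hev : ∀ i, MeasurePreserving (Function.eval i) (Measure.pi fun _ : Fin m => μ) μ :=
    fun i => measurePreserving_eval (fun _ : Fin m => μ) i
  have hfi : Integrable f μ := Integrable.of_bound hf.aestronglyMeasurable C (ae_of_all _ h)
  have hi : ∀ i, Integrable (fun x : Fin m → X => f (x i)) (Measure.pi fun _ : Fin m => μ) :=
    fun i => (hev i).integrable_comp_of_integrable hfi
  have he : ∀ i, ∫ x : Fin m → X, f (x i) ∂(Measure.pi fun _ : Fin m => μ) = ∫ y, f y ∂μ := by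
    intro i
    conv_rhs => rw [← (hev i).map_eq]
    rw [integral_map (hev i).measurable.aemeasurable hf.aestronglyMeasurable]
  simp only [meanDeviation]
  rw [integral_sub (integrable_const _) ((integrable_finsetSum _ fun i _ => hi i).div_const _),
    integral_div, integral_finsetSum _ fun i _ => hi i]
  simp only [he]
  have hm' : (m : ℝ) ≠ 0 := by exact_mod_cast hm.ne'
  simp [hm']

lemma hasSubgaussianMGF_meanDeviation {m : ℕ} (hm : 0 < m) {f : X → ℝ} (hf : Measurable f) {C : ℝ}
    (hC : ∀ y, |f y| ≤ C) {c : NNReal} (h : ∀ y z, |f y - f z| ≤ c) :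
    HasSubgaussianMGF (meanDeviation μ m f) (m * (c / m / 2) ^ 2)
      (Measure.pi fun _ : Fin m => μ) := by
  have := hasSubgaussianMGF_of_boundedDifferences μ (c / m) m (meanDeviation μ m f)
    (measurable_meanDeviation μ m hf) (2 * C) (abs_meanDeviation_le μ hm hC)
    (fun x i y => by simpa using abs_meanDeviation_update_sub_le μ h x i y)
  simpa only [integral_meanDeviation μ hm hf hC, sub_zero] using this

/-- Expected uniform deviation of a Lipschitz-parametrized class, by chaining. -/
lemma integral_iSup_meanDeviation_le {m : ℕ} (hm : 0 < m) {p : ℕ} {T : Type*} [Nonempty T]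
    (θ : T → EuclideanSpace ℝ (Fin p)) (hθ : ∀ t i, θ t i ∈ Set.Icc (-1 : ℝ) 1)
    (f : T → X → ℝ) (hf : ∀ t, Measurable (f t)) {Δ L : ℝ} (hL : 0 ≤ L)
    (hΔ : ∀ t y, |f t y| ≤ Δ) (hlip : ∀ s t y, |f s y - f t y| ≤ L * ‖θ s - θ t‖)
    (hint : Integrable (fun x => ⨆ t, meanDeviation μ m (f t) x) (Measure.pi fun _ : Fin m => μ)) :
    ∫ x, ⨆ t, meanDeviation μ m (f t) x ∂(Measure.pi fun _ : Fin m => μ) ≤ 16 * p * L / √m := by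
  have hm' : (0 : ℝ) < m := by exact_mod_cast hm
  have hfi : ∀ t, Integrable (f t) μ := fun t =>
    Integrable.of_bound (hf t).aestronglyMeasurable Δ (ae_of_all _ (hΔ t))
  -- chaining needs a positive increment scale, and `L` may vanish
  have key : ∀ K : ℝ, L / √m < K →
      ∫ x, ⨆ t, meanDeviation μ m (f t) x ∂(Measure.pi fun _ : Fin m => μ) ≤ 16 * p * K := by
    intro K hK
    have hK0 : 0 < K := lt_of_le_of_lt (by positivity) hK
    refine integral_le_of_subgaussian_increments (B := 2 * L) θ hθ hK0
      (fun t => meanDeviation μ m (f t)) (fun t => integrable_meanDeviation μ hm (hf t) (hΔ t))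
      (fun t => integral_meanDeviation μ hm (hf t) (hΔ t)) ?_ (by positivity) ?_ _ hint
      (fun x b hb => ciSup_le hb)
    · intro s t
      set d := ‖θ s - θ t‖
      have h := hasSubgaussianMGF_meanDeviation μ hm (f := fun y => f s y - f t y)
        ((hf s).sub (hf t)) (hlip s t) (c := Real.toNNReal (2 * (L * d))) (fun y z => by
          rw [Real.coe_toNNReal _ (by positivity)]
          refine (abs_sub _ _).trans ?_
          linarith [hlip s t y, hlip s t z])
      have e : meanDeviation μ m (fun y => f s y - f t y)
          = fun x => meanDeviation μ m (f s) x - meanDeviation μ m (f t) x :=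
        funext fun x => meanDeviation_sub μ (hfi s) (hfi t) x
      rw [e] at h
      refine ⟨h.integrable_exp_mul, fun u => (h.mgf_le u).trans ?_⟩
      have hle : (m * (Real.toNNReal (2 * (L * d)) / m / 2) ^ 2 : NNReal)
          ≤ Real.toNNReal (K * d) ^ 2 := by
        rw [← NNReal.coe_le_coe]
        push_cast
        rw [Real.coe_toNNReal _ (by positivity), Real.coe_toNNReal _ (by positivity)]
        have e1 : (m : ℝ) * (2 * (L * d) / m / 2) ^ 2 = (L / √m * d) ^ 2 := by
          rw [mul_pow (L / √m), div_pow L, Real.sq_sqrt hm'.le]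
          field_simp
        rw [e1]
        gcongr
      gcongr
    · intro s t x
      rw [← meanDeviation_sub μ (hfi s) (hfi t)]
      refine (le_abs_self _).trans ((abs_meanDeviation_le μ hm (hlip s t) x).trans (le_of_eq ?_))
      ring
  have hlim : Tendsto (fun K : ℝ => 16 * p * K) (nhdsWithin (L / √m) (Set.Ioi (L / √m)))
      (nhds (16 * p * (L / √m))) :=
    ((continuous_const.mul continuous_id).tendsto _).mono_left nhdsWithin_le_nhds
  have := ge_of_tendsto hlim (by filter_upwards [self_mem_nhdsWithin] with K hK using key K hK)
  rwa [← mul_div_assoc] at this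

/-- Concentration of the uniform deviation around its mean, by bounded differences. -/
lemma measure_iSup_meanDeviation_ge_le {m : ℕ} (hm : 0 < m) {T : Type*} [Nonempty T] [Countable T]
    (f : T → X → ℝ) (hf : ∀ t, Measurable (f t)) {Δ δ : ℝ} (hΔ0 : 0 < Δ) (hδ : 0 < δ)
    (hδ1 : δ < 1) (hΔ : ∀ t y, |f t y| ≤ Δ) :
    (Measure.pi fun _ : Fin m => μ).real {x | Δ * √(2 * Real.log (1 / δ)) / √m ≤
      (⨆ t, meanDeviation μ m (f t) x) -
        ∫ y, ⨆ t, meanDeviation μ m (f t) y ∂(Measure.pi fun _ : Fin m => μ)} ≤ δ := by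
  have hm' : (0 : ℝ) < m := by exact_mod_cast hm
  have hb : ∀ t x, |meanDeviation μ m (f t) x| ≤ 2 * Δ := fun t x =>
    abs_meanDeviation_le μ hm (hΔ t) x
  have hbdd : ∀ x, BddAbove (Set.range fun t => meanDeviation μ m (f t) x) := fun x =>
    ⟨2 * Δ, by rintro _ ⟨t, rfl⟩; exact (abs_le.1 (hb t x)).2⟩
  have hΦb : ∀ x, |⨆ t, meanDeviation μ m (f t) x| ≤ 2 * Δ := fun x => by
    rw [abs_le]
    obtain ⟨t⟩ := ‹Nonempty T›
    exact ⟨(abs_le.1 (hb t x)).1.trans (le_ciSup (hbdd x) t),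
      have : Nonempty T := ⟨t⟩; ciSup_le fun t => (abs_le.1 (hb t x)).2⟩
  have hosc : ∀ t y z, |f t y - f t z| ≤ 2 * Δ := fun t y z => by
    refine (abs_sub _ _).trans ?_
    linarith [hΔ t y, hΔ t z]
  have hdiff : ∀ x i y, |(⨆ t, meanDeviation μ m (f t) (Function.update x i y)) -
      ⨆ t, meanDeviation μ m (f t) x| ≤ 2 * Δ / m := by
    intro x i y
    have h := fun t => abs_le.1 (abs_meanDeviation_update_sub_le μ (hosc t) x i y)
    have h1 : (⨆ t, meanDeviation μ m (f t) (Function.update x i y))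
        ≤ (⨆ t, meanDeviation μ m (f t) x) + 2 * Δ / m :=
      ciSup_le fun t => by linarith [(h t).2, le_ciSup (hbdd x) t]
    have h2 : (⨆ t, meanDeviation μ m (f t) x)
        ≤ (⨆ t, meanDeviation μ m (f t) (Function.update x i y)) + 2 * Δ / m :=
      ciSup_le fun t => by linarith [(h t).1, le_ciSup (hbdd (Function.update x i y)) t]
    rw [abs_le]
    constructor <;> linarith
  have hsub := hasSubgaussianMGF_of_boundedDifferences μ (Real.toNNReal (2 * Δ / m)) m
    (fun x => ⨆ t, meanDeviation μ m (f t) x)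
    (Measurable.iSup fun t => measurable_meanDeviation μ m (hf t)) (2 * Δ) hΦb
    (fun x i y => by rw [Real.coe_toNNReal _ (by positivity)]; exact hdiff x i y)
  have hlog : 0 < Real.log (1 / δ) := Real.log_pos (by rw [lt_div_iff₀ hδ]; linarith)
  refine (hsub.measure_ge_le (ε := Δ * √(2 * Real.log (1 / δ)) / √m) (by positivity)).trans
    (le_of_eq ?_)
  push_cast
  rw [Real.coe_toNNReal _ (by positivity)]
  have : -(Δ * √(2 * Real.log (1 / δ)) / √m) ^ 2 / (2 * (m * (2 * Δ / m / 2) ^ 2))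
      = -Real.log (1 / δ) := by
    rw [div_pow, mul_pow, Real.sq_sqrt (by positivity), Real.sq_sqrt hm'.le]
    field_simp
  rw [this, one_div, Real.log_inv, neg_neg, Real.exp_log hδ]

/-- With probability at least `1 - δ`, the empirical distribution is within `C_δ / (2 * √m)` of
`μ` in the integral probability metric. -/
theorem exists_measurableSet_ipm_empirical_le {F : Set (X → ℝ)} {p : ℕ} {L Δ δ : ℝ}
    (hF : F.Nonempty) (hFm : ∀ f ∈ F, Measurable f) (hL : 0 ≤ L) (hA2 : IsEvenBounded F Δ)
    (hA3 : IsLipschitzParametrized F p L) (hδ : 0 < δ) (hδ1 : δ < 1) {m : ℕ} (hm : 0 < m) :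
    ∃ S : Set (Fin m → X), MeasurableSet S ∧ (Measure.pi fun _ : Fin m => μ).real Sᶜ ≤ δ ∧
      ∀ x ∈ S, 2 * ipm F μ (empirical x) ≤ genConst p L Δ δ / √m := by
  have hm' : (0 : ℝ) < m := by exact_mod_cast hm
  obtain ⟨y₀⟩ : Nonempty X := μ.nonempty_of_neZero
  have hΔ0 : 0 ≤ Δ := by
    obtain ⟨f, hf⟩ := hF
    exact (abs_nonneg _).trans (hA2.2 f hf y₀)
  -- for `Δ = 0` the class is `{0}`, and the concentration inequality degenerates
  rcases hΔ0.eq_or_lt with rfl | hΔ0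
  · refine ⟨Set.univ, MeasurableSet.univ, by simpa using hδ.le, fun x _ => ?_⟩
    have h0 : ipm F μ (empirical x) ≤ 0 := ipm_le hF _ _ fun f hf => by
      have : ∀ y, f y = 0 := fun y => abs_nonpos_iff.1 (hA2.2 f hf y)
      simp [this]
    have : 0 ≤ genConst p L 0 δ / √m := by
      unfold genConst
      positivity
    linarith
  obtain ⟨Θ, f, rfl, hcube, hlip⟩ := hA3
  obtain ⟨D, hDΘ, hDc, hDd⟩ :=
    (TopologicalSpace.IsSeparable.of_separableSpace Θ).exists_countable_dense_subset
  have : Countable D := hDc.to_subtype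
  have : Nonempty D := by
    obtain ⟨_, θ, hθ, rfl⟩ := hF
    exact (closure_nonempty_iff.1 ⟨θ, hDd hθ⟩).to_subtype
  have hfm : ∀ θ ∈ Θ, Measurable (f θ) := fun θ hθ => hFm _ ⟨θ, hθ, rfl⟩
  have hfΔ : ∀ θ ∈ Θ, ∀ y, |f θ y| ≤ Δ := fun θ hθ => hA2.2 _ ⟨θ, hθ, rfl⟩
  set π := Measure.pi fun _ : Fin m => μ
  set Φ : (Fin m → X) → ℝ := fun x => ⨆ t : D, meanDeviation μ m (f t) x with hΦdef
  have hΦm : Measurable Φ :=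
    Measurable.iSup fun t : D => measurable_meanDeviation μ m (hfm t (hDΘ t.2))
  have hb : ∀ (t : D) x, |meanDeviation μ m (f t) x| ≤ 2 * Δ := fun t x =>
    abs_meanDeviation_le μ hm (hfΔ t (hDΘ t.2)) x
  have hbdd : ∀ x, BddAbove (Set.range fun t : D => meanDeviation μ m (f t) x) := fun x =>
    ⟨2 * Δ, by rintro _ ⟨t, rfl⟩; exact (abs_le.1 (hb t x)).2⟩
  have hΦint : Integrable Φ π := by
    refine Integrable.of_bound hΦm.aestronglyMeasurable (2 * Δ) (ae_of_all _ fun x => ?_)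
    rw [Real.norm_eq_abs, abs_le]
    exact ⟨(abs_le.1 (hb (Classical.arbitrary D) x)).1.trans (le_ciSup (hbdd x) _),
      ciSup_le fun t => (abs_le.1 (hb t x)).2⟩
  have hmean : ∫ x, Φ x ∂π ≤ 16 * p * L / √m :=
    integral_iSup_meanDeviation_le μ hm (fun t : D => (t : EuclideanSpace ℝ (Fin p)))
      (fun t => hcube t (hDΘ t.2)) (fun t : D => f t) (fun t => hfm t (hDΘ t.2)) hL
      (fun t => hfΔ t (hDΘ t.2)) (fun s t => hlip s (hDΘ s.2) t (hDΘ t.2)) hΦint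
  have hconc := measure_iSup_meanDeviation_ge_le μ hm (fun t : D => f t)
    (fun t => hfm t (hDΘ t.2)) hΔ0 hδ hδ1 (fun t => hfΔ t (hDΘ t.2))
  -- by density and the Lipschitz condition, the supremum over `D` dominates the whole class
  have hsup : ∀ θ ∈ Θ, ∀ x, meanDeviation μ m (f θ) x ≤ Φ x := by
    intro θ hθ x
    have hint : ∀ θ ∈ Θ, Integrable (f θ) μ := fun θ hθ =>
      Integrable.of_bound (hfm θ hθ).aestronglyMeasurable Δ (ae_of_all _ (hfΔ θ hθ))
    have hε : ∀ ε > 0, meanDeviation μ m (f θ) x ≤ Φ x + 2 * (L * ε) := by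
      intro ε hε
      obtain ⟨t, htD, ht⟩ := Metric.mem_closure_iff.1 (hDd hθ) ε hε
      have h1 := abs_meanDeviation_le μ hm (hlip θ hθ t (hDΘ htD)) x
      rw [meanDeviation_sub μ (hint θ hθ) (hint t (hDΘ htD))] at h1
      have h2 : meanDeviation μ m (f t) x ≤ Φ x := le_ciSup (hbdd x) ⟨t, htD⟩
      have h3 : L * ‖θ - t‖ ≤ L * ε := by
        gcongr
        rw [← dist_eq_norm]
        exact ht.le
      linarith [(abs_le.1 h1).2]
    have hlim : Tendsto (fun ε : ℝ => Φ x + 2 * (L * ε)) (nhdsWithin 0 (Set.Ioi 0))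
        (nhds (Φ x + 2 * (L * 0))) := by
      refine Tendsto.mono_left (Continuous.tendsto (by fun_prop) _) nhdsWithin_le_nhds
    rw [mul_zero, mul_zero, add_zero] at hlim
    exact ge_of_tendsto hlim (by filter_upwards [self_mem_nhdsWithin] with ε h using hε ε h)
  set b := Δ * √(2 * Real.log (1 / δ)) / √m with hbdef
  refine ⟨{x | b ≤ Φ x - ∫ y, Φ y ∂π}ᶜ,
    (measurableSet_le measurable_const (hΦm.sub_const _)).compl, ?_, ?_⟩
  · rw [compl_compl]
    exact hconc
  · intro x hx
    simp only [Set.mem_compl_iff, Set.mem_ofPred_eq, not_le] at hx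
    have h1 : ipm (f '' Θ) μ (empirical x) ≤ Φ x := by
      refine ipm_le hF _ _ ?_
      rintro _ ⟨θ, hθ, rfl⟩
      rw [integral_empirical x (hfm θ hθ)]
      exact hsup θ hθ x
    have h2 : (2 : ℝ) ≤ √(2 * Real.pi) := by
      apply Real.le_sqrt_of_sq_le
      linarith [Real.pi_gt_three]
    have h3 : 2 * (16 * p * L / √m) ≤ 16 * √(2 * Real.pi) * p * L / √m := by
      have : 0 ≤ (p : ℝ) * L := by positivity
      rw [← mul_div_assoc]
      refine div_le_div_of_nonneg_right ?_ (Real.sqrt_nonneg _)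
      nlinarith
    have h4 : genConst p L Δ δ / √m = 16 * √(2 * Real.pi) * p * L / √m + 2 * b := by
      rw [hbdef, genConst]
      ring
    linarith

end Empirical

/-! ### A symmetrized Pinsker inequality -/

/-- The bound `2 * tanh (l / 2) ≤ l` for `l ≥ 0`, multiplied out and made even in `l`. -/
lemma two_mul_sq_one_sub_exp_neg_le (l : ℝ) :
    2 * (1 - Real.exp (-l)) ^ 2 ≤ (1 - Real.exp (-l)) * l * (1 + Real.exp (-l)) := by
  set h : ℝ → ℝ := fun l => l * (1 + Real.exp (-l)) - 2 * (1 - Real.exp (-l)) with hdef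
  have hder : ∀ x, HasDerivAt h (1 - Real.exp (-x) * (1 + x)) x := by
    intro x
    have he : HasDerivAt (fun x => Real.exp (-x)) (Real.exp (-x) * (-1)) x :=
      (hasDerivAt_neg x).exp
    have := ((hasDerivAt_id x).mul (he.const_add 1)).sub ((he.const_sub 1).const_mul 2)
    refine this.congr_deriv ?_
    simp only [id]
    ring
  have hmono : Monotone h := by
    refine monotone_of_deriv_nonneg (fun x => (hder x).differentiableAt) fun x => ?_
    rw [(hder x).deriv]
    have h1 : Real.exp (-x) * (1 + x) ≤ Real.exp (-x) * Real.exp x := by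
      gcongr
      linarith [Real.add_one_le_exp x]
    rw [← Real.exp_add] at h1
    simp at h1
    linarith
  have h0 : h 0 = 0 := by simp [hdef]
  have key : 0 ≤ (1 - Real.exp (-l)) * h l := by
    rcases le_total 0 l with hl | hl
    · refine mul_nonneg ?_ (h0 ▸ hmono hl)
      have : Real.exp (-l) ≤ 1 := Real.exp_le_one_iff.2 (by linarith)
      linarith
    · refine mul_nonneg_of_nonpos_of_nonpos ?_ (h0 ▸ hmono hl)
      have : 1 ≤ Real.exp (-l) := Real.one_le_exp (by linarith)
      linarith
  simp only [hdef] at key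
  nlinarith

lemma abs_one_sub_exp_neg_le {s : ℝ} (hs : 0 < s) (l : ℝ) :
    |1 - Real.exp (-l)| ≤ s / 2 * (1 + Real.exp (-l)) + (1 - Real.exp (-l)) * l / (4 * s) := by
  have h := two_mul_sq_one_sub_exp_neg_le l
  set r := Real.exp (-l)
  have hr : 0 < 1 + r := by positivity
  set a := |1 - r|
  have ha : a ^ 2 = (1 - r) ^ 2 := sq_abs _
  -- arithmetic-geometric mean inequality between `s * (1 + r)` and `a ^ 2 / (s * (1 + r))`
  have hamgm : a ≤ s / 2 * (1 + r) + a ^ 2 / (2 * s * (1 + r)) := by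
    rw [← sub_nonneg]
    have : s / 2 * (1 + r) + a ^ 2 / (2 * s * (1 + r)) - a
        = (s * (1 + r) - a) ^ 2 / (2 * s * (1 + r)) := by
      field_simp
      ring
    rw [this]
    positivity
  have h2 : a ^ 2 / (2 * s * (1 + r)) ≤ (1 - r) * l / (4 * s) := by
    rw [div_le_div_iff₀ (by positivity) (by positivity), ha]
    nlinarith
  linarith

lemma integral_eq_integral_exp_neg_llr_mul {X : Type*} [MeasurableSpace X] {μ ν : Measure X}
    [IsProbabilityMeasure μ] [IsProbabilityMeasure ν] (hμν : μ ≪ ν) (hνμ : ν ≪ μ) (f : X → ℝ) :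
    ∫ x, f x ∂ν = ∫ x, Real.exp (-llr μ ν x) * f x ∂μ := by
  rw [← integral_rnDeriv_smul hνμ]
  refine integral_congr_ae ?_
  filter_upwards [exp_neg_llr hμν] with x hx
  rw [← hx, smul_eq_mul]

/-- If the symmetrized Kullback-Leibler divergence `E_μ log (ρ_μ / ρ_ν) - E_ν log (ρ_μ / ρ_ν)` is
at most `K`, then no randomized test tells `μ` and `ν` apart by more than `√K / 2`. -/
theorem integral_le_integral_add_of_symm_klDiv_le {X : Type*} [MeasurableSpace X] {μ ν : Measure X}
    [IsProbabilityMeasure μ] [IsProbabilityMeasure ν] (hμν : μ ≪ ν) (hνμ : ν ≪ μ) {C : ℝ}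
    (hC : ∀ᵐ x ∂μ, |llr μ ν x| ≤ C) {K : ℝ} (hK : 0 ≤ K)
    (hJ : ∫ x, llr μ ν x ∂μ - ∫ x, llr μ ν x ∂ν ≤ K) {φ : X → ℝ} (hφ : Measurable φ)
    (hφ01 : ∀ x, φ x ∈ Set.Icc (0 : ℝ) 1) :
    ∫ x, φ x ∂ν ≤ ∫ x, φ x ∂μ + √K / 2 := by
  set l := llr μ ν
  have hl : Measurable l := measurable_llr μ ν
  have hlint : Integrable l μ := Integrable.of_bound hl.aestronglyMeasurable C hC
  have hr : Integrable (fun x => Real.exp (-l x)) μ := by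
    refine Integrable.of_bound (by fun_prop) (Real.exp C) ?_
    filter_upwards [hC] with x hx
    rw [Real.norm_eq_abs, Real.abs_exp]
    exact Real.exp_le_exp.2 (by linarith [(abs_le.1 hx).1])
  have hφb : ∀ᵐ x ∂μ, ‖φ x‖ ≤ 1 := ae_of_all _ fun x => by
    rw [Real.norm_eq_abs, abs_of_nonneg (hφ01 x).1]
    exact (hφ01 x).2
  have hφint : Integrable φ μ := Integrable.of_bound hφ.aestronglyMeasurable 1 hφb
  have hrl : Integrable (fun x => Real.exp (-l x) * l x) μ := hr.mul_bdd hl.aestronglyMeasurable hC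
  have hrφ : Integrable (fun x => Real.exp (-l x) * φ x) μ :=
    hr.mul_bdd hφ.aestronglyMeasurable hφb
  have hr1 : ∫ x, Real.exp (-l x) ∂μ = 1 := by
    have := integral_eq_integral_exp_neg_llr_mul hμν hνμ (fun _ => (1 : ℝ))
    simpa using this.symm
  have hJ' : ∫ x, (1 - Real.exp (-l x)) * l x ∂μ ≤ K := by
    have e : ∀ x, (1 - Real.exp (-l x)) * l x = l x - Real.exp (-l x) * l x := fun x => by ring
    simp_rw [e]
    rw [integral_sub hlint hrl, ← integral_eq_integral_exp_neg_llr_mul hμν hνμ]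
    exact hJ
  have hprod : Integrable (fun x => (1 - Real.exp (-l x)) * l x) μ := by
    refine (hlint.sub hrl).congr (ae_of_all _ fun x => ?_)
    simp only [Pi.sub_apply]
    ring
  have hi3 : Integrable (fun x => Real.exp (-l x) * φ x - φ x) μ := hrφ.sub hφint
  have hi4 : Integrable (fun x => (Real.exp (-l x) - 1) / 2) μ :=
    (hr.sub (integrable_const _)).div_const _
  have key : ∀ s : ℝ, 0 < s → ∫ x, φ x ∂ν - ∫ x, φ x ∂μ ≤ s / 2 + K / (8 * s) := by
    intro s hs
    -- replacing `φ` by `φ - 1 / 2`, at most `1 / 2` in absolute value, keeps the difference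
    have e1 : ∫ x, φ x ∂ν - ∫ x, φ x ∂μ
        = ∫ x, (Real.exp (-l x) * φ x - φ x) - (Real.exp (-l x) - 1) / 2 ∂μ := by
      rw [integral_sub hi3 hi4,
        integral_sub hrφ hφint, integral_div, integral_sub hr (integrable_const _), hr1,
        ← integral_eq_integral_exp_neg_llr_mul hμν hνμ]
      simp
    have hpt : ∀ x, (Real.exp (-l x) * φ x - φ x) - (Real.exp (-l x) - 1) / 2
        ≤ s / 4 * (1 + Real.exp (-l x)) + (1 - Real.exp (-l x)) * l x / (8 * s) := by
      intro x
      have h1 := abs_one_sub_exp_neg_le hs (l x)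
      have h2 : (1 - Real.exp (-l x)) * (1 / 2 - φ x) ≤ |1 - Real.exp (-l x)| * (1 / 2) := by
        refine (le_abs_self _).trans ?_
        rw [abs_mul]
        gcongr
        rw [abs_le]
        constructor <;> linarith [(hφ01 x).1, (hφ01 x).2]
      have h3 : (1 - Real.exp (-l x)) * l x / (8 * s)
          = (1 - Real.exp (-l x)) * l x / (4 * s) * (1 / 2) := by
        field_simp
        ring
      rw [h3]
      linarith
    have hi1 : Integrable (fun x => s / 4 * (1 + Real.exp (-l x))) μ :=
      ((integrable_const _).add hr).const_mul _
    have hi2 : Integrable (fun x => (1 - Real.exp (-l x)) * l x / (8 * s)) μ := hprod.div_const _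
    rw [e1]
    refine (integral_mono (hi3.sub hi4) (hi1.add hi2) hpt).trans ?_
    simp only [Pi.add_apply]
    rw [integral_add hi1 hi2, integral_const_mul, integral_add (integrable_const _) hr, hr1,
      integral_div]
    simp only [integral_const, probReal_univ, smul_eq_mul, one_mul]
    have : (∫ x, (1 - Real.exp (-l x)) * l x ∂μ) / (8 * s) ≤ K / (8 * s) := by gcongr
    linarith
  rcases hK.eq_or_lt with rfl | hK
  · have : ∫ x, φ x ∂ν - ∫ x, φ x ∂μ ≤ 0 := le_of_forall_pos_le_add fun ε hε => by
      have := key ε hε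
      simp only [zero_div, add_zero] at this
      linarith
    simp only [Real.sqrt_zero, zero_div, add_zero]
    linarith
  · -- the optimal parameter of the arithmetic-geometric mean inequality
    have h := key (√K / 2) (by positivity)
    have e : K / (8 * (√K / 2)) = √K / 4 := by
      rw [div_eq_div_iff (by positivity) (by norm_num)]
      nlinarith [Real.mul_self_sqrt hK.le]
    rw [e] at h
    linarith

/-! ### Symmetrized divergence and discriminators -/

section Span

variable {X : Type*} [MeasurableSpace X] {F : Set (X → ℝ)} {Δ : ℝ}

lemma IsCombination.ae_abs_le (hA2 : IsEvenBounded F Δ) {κ : Measure X} {h : X → ℝ} {n : ℕ}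
    {w₀ : ℝ} {w : Fin n → ℝ} {f : Fin n → X → ℝ} (hc : IsCombination F κ h n w₀ w f) :
    ∀ᵐ x ∂κ, |h x| ≤ |w₀| + ∑ i, |w i| * Δ := by
  filter_upwards [hc.2] with x hx
  rw [hx]
  refine (abs_add_le _ _).trans ?_
  gcongr
  refine (Finset.abs_sum_le_sum_abs _ _).trans (Finset.sum_le_sum fun i _ => ?_)
  rw [abs_mul]
  gcongr
  exact hA2.2 _ (hc.1 i) x

/-- The difference of expectations of a combination of discriminators is bounded by the integral
probability metric. -/
lemma IsCombination.integral_sub_le (hFm : ∀ f ∈ F, Measurable f) (hA2 : IsEvenBounded F Δ)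
    {μ ν : Measure X} [IsProbabilityMeasure μ] [IsProbabilityMeasure ν] (hνμ : ν ≪ μ) {h : X → ℝ}
    {n : ℕ} {w₀ : ℝ} {w : Fin n → ℝ} {f : Fin n → X → ℝ} (hc : IsCombination F μ h n w₀ w f) :
    ∫ x, h x ∂μ - ∫ x, h x ∂ν ≤ (∑ i, |w i|) * ipm F μ ν := by
  have hint : ∀ κ : Measure X, IsProbabilityMeasure κ → κ ≪ μ →
      ∫ x, h x ∂κ = w₀ + ∑ i, w i * ∫ x, f i x ∂κ := by
    intro κ _ hκ
    have hi : ∀ i, Integrable (fun x => w i * f i x) κ := fun i =>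
      (hA2.integrable hFm κ (hc.1 i)).const_mul _
    rw [integral_congr_ae (hκ.ae_eq hc.2),
      integral_add (integrable_const _) (integrable_finsetSum _ fun i _ => hi i),
      integral_finsetSum _ fun i _ => hi i]
    simp [integral_const_mul]
  rw [hint μ inferInstance Measure.AbsolutelyContinuous.rfl, hint ν inferInstance hνμ,
    add_sub_add_left_eq_sub, ← Finset.sum_sub_distrib, Finset.sum_mul]
  refine Finset.sum_le_sum fun i _ => ?_
  rw [← mul_sub]
  refine (le_abs_self _).trans ?_
  rw [abs_mul]
  gcongr
  exact abs_integral_sub_le_ipm hA2 μ ν (hc.1 i)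

lemma exists_isCombination_sum_lt {κ : Measure X} {h : X → ℝ} {Γ : ℝ≥0∞} (hΓ : Γ ≠ ∞)
    (hle : variationNorm F κ h ≤ Γ) {ε : ℝ} (hε : 0 < ε) :
    ∃ n w₀ w f, IsCombination F κ h n w₀ w f ∧ ∑ i, |w i| < Γ.toReal + ε := by
  have hlt : variationNorm F κ h < ENNReal.ofReal (Γ.toReal + ε) := by
    refine hle.trans_lt ?_
    rw [← ENNReal.ofReal_toReal hΓ, ENNReal.toReal_ofReal ENNReal.toReal_nonneg]
    exact (ENNReal.ofReal_lt_ofReal_iff (by positivity)).2 (by linarith)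
  obtain ⟨c, ⟨n, w₀, w, f, hc, rfl⟩, hlt⟩ := sInf_lt_iff.1 hlt
  exact ⟨n, w₀, w, f, hc, (ENNReal.ofReal_lt_ofReal_iff (by positivity)).1 hlt⟩

/-- Against every generator in `G`, a randomized test has a true positive rate which exceeds its
false positive rate by at most `√(Γ_μ * d_F(μ, ν)) / 2`. -/
theorem integral_le_integral_add_of_mem {G : Set (ProbabilityMeasure X)} {μ : Measure X}
    [IsProbabilityMeasure μ] (hF : F.Nonempty) (hFm : ∀ f ∈ F, Measurable f)
    (hA2 : IsEvenBounded F Δ) (hΓ : complexity F G μ ≠ ∞) {ν : ProbabilityMeasure X} (hν : ν ∈ G)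
    (hspan : LogRatioInSpan F μ (ν : Measure X)) {φ : X → ℝ} (hφ : Measurable φ)
    (hφ01 : ∀ x, φ x ∈ Set.Icc (0 : ℝ) 1) :
    ∫ x, φ x ∂(ν : Measure X) ≤
      ∫ x, φ x ∂μ + √((complexity F G μ).toReal * ipm F μ (ν : Measure X)) / 2 := by
  obtain ⟨hμν, hνμ, n, w₀, w, f, hc⟩ := hspan
  have hd := ipm_nonneg hF hA2 μ (ν : Measure X)
  refine integral_le_integral_add_of_symm_klDiv_le hμν hνμ (hc.ae_abs_le hA2)
    (mul_nonneg ENNReal.toReal_nonneg hd) ?_ hφ hφ01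
  have hle : variationNorm F μ (llr μ (ν : Measure X)) ≤ complexity F G μ :=
    le_iSup₂ (f := fun (ν : ProbabilityMeasure X) (_ : ν ∈ G) =>
      variationNorm F μ (llr μ (ν : Measure X))) ν hν
  have key : ∀ ε > 0, ∫ x, llr μ (ν : Measure X) x ∂μ - ∫ x, llr μ (ν : Measure X) x ∂ν
      ≤ ((complexity F G μ).toReal + ε) * ipm F μ (ν : Measure X) := by
    intro ε hε
    obtain ⟨n, w₀, w, f, hc, hlt⟩ := exists_isCombination_sum_lt hΓ hle hε
    refine (hc.integral_sub_le hFm hA2 hνμ).trans ?_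
    gcongr
  have hlim : Tendsto (fun ε : ℝ => ((complexity F G μ).toReal + ε) * ipm F μ (ν : Measure X))
      (nhdsWithin 0 (Set.Ioi 0))
      (nhds (((complexity F G μ).toReal + 0) * ipm F μ (ν : Measure X))) :=
    Tendsto.mono_left (Continuous.tendsto (by fun_prop) _) nhdsWithin_le_nhds
  rw [add_zero] at hlim
  exact ge_of_tendsto hlim (by filter_upwards [self_mem_nhdsWithin] with ε h using key ε h)

end Span

/-! ### The law of a training sample given the generator -/

section Member

variable {X : Type*} [MeasurableSpace X]

lemma pi_withDensity_prod (μ : Measure X) [IsProbabilityMeasure μ] {h : X → ℝ≥0∞}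
    (hh : Measurable h) [SigmaFinite (μ.withDensity h)] (m : ℕ) :
    (Measure.pi fun _ : Fin m => μ).withDensity (fun x => ∏ i, h (x i))
      = Measure.pi fun _ => μ.withDensity h := by
  symm
  refine Measure.pi_eq fun s hs => ?_
  have hind : (Set.univ.pi s).indicator (fun x : Fin m → X => ∏ i, h (x i))
      = fun x => ∏ i, (s i).indicator h (x i) := by
    funext x
    by_cases hx : x ∈ Set.univ.pi s
    · rw [Set.indicator_of_mem hx]
      exact Finset.prod_congr rfl fun i _ => (Set.indicator_of_mem (hx i trivial) _).symm
    · rw [Set.indicator_of_notMem hx]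
      simp only [Set.mem_univ_pi, not_forall] at hx
      obtain ⟨i, hi⟩ := hx
      exact (Finset.prod_eq_zero (Finset.mem_univ i) (Set.indicator_of_notMem hi _)).symm
  have hsm : ∀ i, Measurable ((s i).indicator h) := fun i => hh.indicator (hs i)
  have hindep : iIndepFun (fun i (x : Fin m → X) => (s i).indicator h (x i))
      (Measure.pi fun _ : Fin m => μ) := iIndepFun_pi fun i => (hsm i).aemeasurable
  rw [withDensity_apply _ (MeasurableSet.univ_pi hs),
    ← lintegral_indicator (MeasurableSet.univ_pi hs),
    hind, lintegral_prod_eq_prod_lintegral_of_indepFun Finset.univ _ hindep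
      (fun i => (hsm i).comp (measurable_pi_apply i))]
  refine Finset.prod_congr rfl fun i _ => ?_
  rw [withDensity_apply _ (hs i), ← lintegral_indicator (hs i)]
  exact (measurePreserving_eval (fun _ : Fin m => μ) i).lintegral_comp (hsm i)

lemma withDensity_exp_neg_llr {μ ν : Measure X} [IsProbabilityMeasure μ] [IsProbabilityMeasure ν]
    (hμν : μ ≪ ν) (hνμ : ν ≪ μ) :
    μ.withDensity (fun x => ENNReal.ofReal (Real.exp (-llr μ ν x))) = ν := by
  rw [← Measure.withDensity_rnDeriv_eq ν μ hνμ]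
  refine withDensity_congr_ae ?_
  rw [Measure.withDensity_rnDeriv_eq ν μ hνμ]
  filter_upwards [exp_neg_llr hμν, Measure.rnDeriv_lt_top ν μ] with x hx hlt
  rw [hx, ENNReal.ofReal_toReal hlt.ne]

/-- The likelihood turns the prior `μ^m` of the training set into the posterior `g^m`. -/
lemma datasetPosterior_eq {μ g : Measure X} [IsProbabilityMeasure μ] [IsProbabilityMeasure g]
    (hμg : μ ≪ g) (hgμ : g ≪ μ) (m : ℕ) :
    datasetPosterior μ g m = Measure.pi fun _ => g := by
  have hd : (fun x : Fin m → X => ENNReal.ofReal (Real.exp (-∑ i, loss μ g (x i))))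
      = fun x => ∏ i, ENNReal.ofReal (Real.exp (-llr μ g (x i))) := by
    funext x
    rw [← Finset.sum_neg_distrib, Real.exp_sum,
      ENNReal.ofReal_prod_of_nonneg fun i _ => (Real.exp_pos _).le]
    rfl
  have hw := withDensity_exp_neg_llr hμg hgμ
  have hm : Measurable fun x => ENNReal.ofReal (Real.exp (-llr μ g x)) :=
    ((measurable_llr μ g).neg.exp).ennreal_ofReal
  have : SigmaFinite (μ.withDensity fun x => ENNReal.ofReal (Real.exp (-llr μ g x))) := by
    rw [hw]
    infer_instance
  have hW : (Measure.pi fun _ : Fin m => μ).withDensity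
      (fun x => ENNReal.ofReal (Real.exp (-∑ i, loss μ g (x i)))) = Measure.pi fun _ => g := by
    rw [hd, pi_withDensity_prod μ hm m]
    simp only [hw]
  rw [datasetPosterior, hW]
  simp

theorem memberLaw_eq {μ g : Measure X} [IsProbabilityMeasure μ] [IsProbabilityMeasure g]
    (hμg : μ ≪ g) (hgμ : g ≪ μ) {m : ℕ} (hm : 0 < m) : memberLaw μ g m = g := by
  have hmap : ∀ i, (datasetPosterior μ g m).map (fun x => x i) = g := fun i => by
    rw [datasetPosterior_eq hμg hgμ]
    exact (measurePreserving_eval (fun _ : Fin m => g) i).map_eq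
  rw [memberLaw]
  simp only [hmap, Finset.sum_const, Finset.card_univ, Fintype.card_fin]
  rw [← Nat.cast_smul_eq_nsmul ℝ≥0∞, smul_smul,
    ENNReal.inv_mul_cancel (by exact_mod_cast hm.ne') (ENNReal.natCast_ne_top m), one_smul]

end Member

/-! ### Tightness of the bound -/

/-- The probability measure with mass `1 - e` at `a` and mass `e` at `b`. -/
noncomputable def twoPoint (a b e : ℝ) : Measure ℝ :=
  ENNReal.ofReal (1 - e) • Measure.dirac a + ENNReal.ofReal e • Measure.dirac b

lemma isProbabilityMeasure_twoPoint (a b : ℝ) {e : ℝ} (he : e ∈ Set.Icc (0 : ℝ) 1) :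
    IsProbabilityMeasure (twoPoint a b e) := by
  constructor
  simp only [twoPoint, Measure.add_apply, Measure.smul_apply, measure_univ, smul_eq_mul, mul_one]
  rw [← ENNReal.ofReal_add (by linarith [he.2]) he.1]
  simp

lemma integral_twoPoint (a b : ℝ) {e : ℝ} (he : e ∈ Set.Icc (0 : ℝ) 1) (f : ℝ → ℝ) :
    ∫ x, f x ∂(twoPoint a b e) = (1 - e) * f a + e * f b := by
  rw [twoPoint, integral_add_measure, integral_smul_measure, integral_smul_measure,
    integral_dirac, integral_dirac, ENNReal.toReal_ofReal (by linarith [he.2]),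
    ENNReal.toReal_ofReal he.1, smul_eq_mul, smul_eq_mul]
  · exact (integrable_dirac (by simp)).smul_measure ENNReal.ofReal_ne_top
  · exact (integrable_dirac (by simp)).smul_measure ENNReal.ofReal_ne_top

lemma real_twoPoint (a b : ℝ) {e : ℝ} (he : e ∈ Set.Icc (0 : ℝ) 1) {S : Set ℝ}
    (hS : MeasurableSet S) :
    (twoPoint a b e).real S = (1 - e) * S.indicator 1 a + e * S.indicator 1 b := by
  rw [← integral_indicator_one hS, integral_twoPoint a b he]

lemma tvDist_twoPoint {e : ℝ} (he : e ∈ Set.Icc (0 : ℝ) 1) :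
    tvDist (twoPoint 0 1 e) (twoPoint 0 2 e) = e := by
  have hle : ∀ S : {S : Set ℝ // MeasurableSet S},
      |(twoPoint 0 1 e).real S.1 - (twoPoint 0 2 e).real S.1| ≤ e := by
    rintro ⟨S, hS⟩
    simp only [real_twoPoint _ _ he hS]
    have h : ∀ a : ℝ, S.indicator (1 : ℝ → ℝ) a ∈ Set.Icc (0 : ℝ) 1 := fun a => by
      by_cases ha : a ∈ S <;> simp [ha]
    have h1 := h 1
    have h2 := h 2
    have := he.1
    rw [abs_le]
    constructor <;> nlinarith [h1.1, h1.2, h2.1, h2.2]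
  refine le_antisymm (Real.iSup_le hle he.1) ?_
  have h := le_ciSup (f := fun S : {S : Set ℝ // MeasurableSet S} =>
    |(twoPoint 0 1 e).real S.1 - (twoPoint 0 2 e).real S.1|)
    ⟨e, by rintro _ ⟨S, rfl⟩; exact hle S⟩ ⟨{1}, measurableSet_singleton 1⟩
  refine le_trans ?_ h
  simp only [real_twoPoint _ _ he (measurableSet_singleton (1 : ℝ))]
  simp [abs_of_nonneg he.1]

/-- The likelihood ratio test of `twoPoint 0 2 e` against `twoPoint 0 1 e` with false positive rate
`u`, randomized at the points `0` and `1`. -/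
noncomputable def twoPointTest (e u : ℝ) (he : e ∈ Set.Icc (0 : ℝ) 1)
    (hu : u ∈ Set.Icc (0 : ℝ) 1) : Decision ℝ where
  accept x := if x = 2 then 1 else if x = 0 then min u (1 - e) / (1 - e)
    else max (u - (1 - e)) 0 / e
  measurable_accept := Measurable.ite (measurableSet_singleton _) measurable_const
    (Measurable.ite (measurableSet_singleton _) measurable_const measurable_const)
  accept_mem x := by
    have h1 : 0 ≤ 1 - e := by linarith [he.2]
    split_ifs
    · simp
    · exact ⟨div_nonneg (le_min hu.1 h1) h1, div_le_one_of_le₀ (min_le_right _ _) h1⟩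
    · exact ⟨div_nonneg (le_max_right _ _) he.1,
        div_le_one_of_le₀ (max_le (by linarith [hu.2]) he.1) he.1⟩

lemma integral_twoPointTest_neg {e u : ℝ} (he : e ∈ Set.Icc (0 : ℝ) 1)
    (hu : u ∈ Set.Icc (0 : ℝ) 1) :
    ∫ x, (twoPointTest e u he hu).accept x ∂(twoPoint 0 1 e) = u := by
  rw [integral_twoPoint _ _ he]
  simp only [twoPointTest]
  norm_num
  -- the test divides by `0` if `e = 1`, but then only on a null set
  have h1 : (1 - e) * (min u (1 - e) / (1 - e)) = min u (1 - e) := by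
    rcases eq_or_ne (1 - e) 0 with h | h
    · rw [h, zero_mul, min_eq_right hu.1]
    · exact mul_div_cancel₀ _ h
  have h2 : e * (max (u - (1 - e)) 0 / e) = max (u - (1 - e)) 0 := by
    rcases eq_or_ne e 0 with rfl | h
    · rw [zero_mul, max_eq_right (by linarith [hu.2])]
    · exact mul_div_cancel₀ _ h
  rw [h1, h2]
  rcases le_total u (1 - e) with h | h
  · rw [min_eq_left h, max_eq_right (by linarith), add_zero]
  · rw [min_eq_right h, max_eq_left (by linarith)]
    ring

lemma integral_twoPointTest_pos {e u : ℝ} (he : e ∈ Set.Icc (0 : ℝ) 1)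
    (hu : u ∈ Set.Icc (0 : ℝ) 1) :
    ∫ x, (twoPointTest e u he hu).accept x ∂(twoPoint 0 2 e) = rocBound e u := by
  rw [integral_twoPoint _ _ he]
  simp only [twoPointTest, rocBound]
  norm_num
  -- the test divides by `0` if `e = 1`, but then only on a null set
  have h1 : (1 - e) * (min u (1 - e) / (1 - e)) = min u (1 - e) := by
    rcases eq_or_ne (1 - e) 0 with h | h
    · rw [h, zero_mul, min_eq_right hu.1]
    · exact mul_div_cancel₀ _ h
  rw [h1, ← min_add_add_right, sub_add_cancel]

theorem exists_rocCurve_eq_graph {ε : ℝ} (hε : 0 ≤ ε) :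
    ∃ μ' g' : ProbabilityMeasure ℝ,
      tvDist (μ' : Measure ℝ) (g' : Measure ℝ) = min ε 1 ∧
      ∃ A : AttackPolicy ℝ, rocCurve A (g' : Measure ℝ) (μ' : Measure ℝ) =
        (fun t => (t, rocBound ε t)) '' Set.Icc (0 : ℝ) 1 := by
  set e := min ε 1
  have he : e ∈ Set.Icc (0 : ℝ) 1 := ⟨le_min hε zero_le_one, min_le_right _ _⟩
  have hroc : ∀ u ∈ Set.Icc (0 : ℝ) 1, rocBound e u = rocBound ε u := by
    intro u hu
    simp only [rocBound, e]
    rw [← min_add_add_left, min_assoc, min_eq_right (a := u + 1) (by linarith [hu.1])]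
  refine ⟨⟨twoPoint 0 1 e, isProbabilityMeasure_twoPoint _ _ he⟩,
    ⟨twoPoint 0 2 e, isProbabilityMeasure_twoPoint _ _ he⟩, tvDist_twoPoint he,
    fun t => twoPointTest e (Set.projIcc 0 1 zero_le_one t) he (Set.projIcc 0 1 zero_le_one t).2,
    ?_⟩
  simp only [rocCurve, ProbabilityMeasure.coe_mk, integral_twoPointTest_neg,
    integral_twoPointTest_pos]
  ext z
  constructor
  · rintro ⟨t, rfl⟩
    have ht := (Set.projIcc (0 : ℝ) 1 zero_le_one t).2
    exact ⟨_, ht, by simp only [hroc _ ht]⟩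
  · rintro ⟨u, hu, rfl⟩
    exact ⟨u, by simp only [Set.projIcc_of_mem zero_le_one hu, hroc u hu]⟩

/-! ### Rates -/

section Rates

variable {X : Type*} [MeasurableSpace X] {F : Set (X → ℝ)} {G : Set (ProbabilityMeasure X)}
  {μ : Measure X} {p : ℕ} {L Δ : ℝ}

lemma epsTV_eq (τ : ℝ) (k : ℕ) (δ : ℝ) :
    epsTV F G μ p L Δ τ k δ = √((complexity F G μ).toReal * (approxErr F G μ + τ) +
      (complexity F G μ).toReal * genConst p L Δ δ / √(k : ℝ)) / 2 := by
  have h : (complexity F G μ).toReal * epsF F G μ p L Δ τ k δ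
      = 2 * ((complexity F G μ).toReal * (approxErr F G μ + τ) +
        (complexity F G μ).toReal * genConst p L Δ δ / √(k : ℝ)) := by
    rw [epsF]
    ring
  rw [epsTV, h, Real.sqrt_mul zero_le_two, mul_comm (2 : ℝ) (√2),
    mul_div_mul_left _ _ (by positivity)]

/-- The square root is subadditive even if the first summand is negative, its root then being `0`;
the errors to which this is applied have no sign a priori. -/
lemma sqrt_add_le_sqrt_add_sqrt_of_right_nonneg (a : ℝ) {b : ℝ} (hb : 0 ≤ b) :
    √(a + b) ≤ √a + √b := by
  refine Real.sqrt_le_iff.2 ⟨by positivity, ?_⟩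
  have h1 : a ≤ √a ^ 2 := by
    rcases le_total 0 a with h | h
    · rw [Real.sq_sqrt h]
    · exact h.trans (sq_nonneg _)
  nlinarith [Real.sq_sqrt hb, mul_nonneg (Real.sqrt_nonneg a) (Real.sqrt_nonneg b)]

lemma sqrt_div_sqrt_natCast {a : ℝ} (ha : 0 ≤ a) (k : ℕ) :
    √(a / √(k : ℝ)) = √a * (k : ℝ) ^ (-(1 / 4) : ℝ) := by
  rw [Real.sqrt_div ha, div_eq_mul_inv, Real.rpow_neg (Nat.cast_nonneg k),
    Real.sqrt_eq_rpow (√(k : ℝ)), Real.sqrt_eq_rpow (k : ℝ), ← Real.rpow_mul (Nat.cast_nonneg k)]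
  norm_num

theorem epsTV_le (hL : 0 ≤ L) (hΔ : 0 ≤ Δ) (τ δ : ℝ) (k : ℕ) :
    epsTV F G μ p L Δ τ k δ ≤
      √((complexity F G μ).toReal * (approxErr F G μ + τ)) / 2 +
        √((complexity F G μ).toReal * genConst p L Δ δ) / 2 * (k : ℝ) ^ (-(1 / 4) : ℝ) := by
  have hC : 0 ≤ (complexity F G μ).toReal * genConst p L Δ δ := by
    unfold genConst
    positivity
  rw [epsTV_eq]
  have h := sqrt_add_le_sqrt_add_sqrt_of_right_nonneg
    ((complexity F G μ).toReal * (approxErr F G μ + τ))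
    (div_nonneg hC (Real.sqrt_nonneg (k : ℝ)))
  rw [sqrt_div_sqrt_natCast hC] at h
  linarith

theorem epsTV_isBigO (hL : 0 ≤ L) (hΔ : 0 ≤ Δ) (δ : ℝ) {τ : ℕ → ℝ}
    (hτ : (fun k : ℕ => approxErr F G μ + τ k)
      =O[atTop] (fun k : ℕ => (k : ℝ) ^ (-(1 / 2) : ℝ))) :
    (fun k : ℕ => epsTV F G μ p L Δ (τ k) k δ)
      =O[atTop] (fun k : ℕ => (k : ℝ) ^ (-(1 / 4) : ℝ)) := by
  obtain ⟨c, hc0, hc⟩ := hτ.exists_pos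
  rw [Asymptotics.IsBigOWith] at hc
  refine Asymptotics.IsBigO.of_bound (√((complexity F G μ).toReal * c) / 2 +
    √((complexity F G μ).toReal * genConst p L Δ δ) / 2) ?_
  filter_upwards [hc] with k hk
  have hk0 : (0 : ℝ) ≤ k := Nat.cast_nonneg k
  have h1 := epsTV_le (F := F) (G := G) (μ := μ) (p := p) hL hΔ (τ k) δ k
  have h2 : 0 ≤ epsTV F G μ p L Δ (τ k) k δ := by
    unfold epsTV
    positivity
  rw [Real.norm_of_nonneg h2, Real.norm_of_nonneg (Real.rpow_nonneg hk0 _)]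
  rw [Real.norm_of_nonneg (Real.rpow_nonneg hk0 _)] at hk
  have h3 : √((complexity F G μ).toReal * (approxErr F G μ + τ k))
      ≤ √((complexity F G μ).toReal * c) * (k : ℝ) ^ (-(1 / 4) : ℝ) := by
    rw [← sqrt_div_sqrt_natCast (by positivity)]
    refine Real.sqrt_le_sqrt ?_
    rw [mul_div_assoc]
    gcongr
    refine (le_abs_self _).trans (hk.trans (le_of_eq ?_))
    rw [Real.rpow_neg hk0, Real.sqrt_eq_rpow]
    rfl
  linarith

end Rates

/-! ### The trained generator -/

section Trained

variable {X : Type*} [MeasurableSpace X] {F : Set (X → ℝ)} {G : Set (ProbabilityMeasure X)}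
  {p : ℕ} {L Δ τ δ : ℝ}

/-- Generalization bound: the distance between `μ` and the trained generator is at most
`ε_F(m, δ) / 2` on an event of probability at least `1 - δ`, which is measurable although the
generator need not depend measurably on the randomness. -/
theorem exists_measurableSet_ipm_trained_le {Ω : Type*} [MeasurableSpace Ω]
    (μ : Measure X) [IsProbabilityMeasure μ] (hF : F.Nonempty) (hFm : ∀ f ∈ F, Measurable f)
    (hL : 0 ≤ L) (hA2 : IsEvenBounded F Δ) (hA3 : IsLipschitzParametrized F p L)
    (hδ : 0 < δ) (hδ1 : δ < 1) (P : Measure Ω) [IsProbabilityMeasure P] {m : ℕ} (hm : 0 < m)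
    (x : Fin m → Ω → X) (hxm : ∀ i, Measurable (x i)) (hxlaw : ∀ i, P.map (x i) = μ)
    (hxind : iIndepFun x P) (g : Ω → ProbabilityMeasure X) (hgG : ∀ ω, g ω ∈ G)
    (hgopt : ∀ᵐ ω ∂P, ipm F (empirical fun i => x i ω) (g ω : Measure X) -
        (⨅ ν : G, ipm F (empirical fun i => x i ω) (ν.1 : Measure X)) ≤ τ) :
    ∃ E : Set Ω, MeasurableSet E ∧ ENNReal.ofReal (1 - δ) ≤ P E ∧
      ∀ ω ∈ E, ipm F μ (g ω : Measure X) ≤ epsF F G μ p L Δ τ m δ / 2 := by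
  obtain ⟨S, hS, hSδ, hSle⟩ :=
    exists_measurableSet_ipm_empirical_le μ hF hFm hL hA2 hA3 hδ hδ1 hm
  obtain ⟨N, hN, hNm, hN0⟩ := exists_measurable_superset_of_null (ae_iff.1 hgopt)
  have hX : Measurable fun ω i => x i ω := measurable_pi_lambda _ hxm
  have hlaw : P.map (fun ω i => x i ω) = Measure.pi fun _ => μ := by
    rw [(iIndepFun_iff_map_fun_eq_pi_map fun i => (hxm i).aemeasurable).1 hxind]
    simp only [hxlaw]
  refine ⟨(fun ω i => x i ω) ⁻¹' S \ N, (hX hS).diff hNm, ?_, ?_⟩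
  · rw [measure_sdiff_null hN0, ← Measure.map_apply hX hS, hlaw]
    have h := probReal_compl_eq_one_sub (μ := Measure.pi fun _ : Fin m => μ) hS
    rw [← ofReal_measureReal]
    exact ENNReal.ofReal_le_ofReal (by linarith)
  · rintro ω ⟨hωS, hωN⟩
    have := isProbabilityMeasure_empirical hm fun i => x i ω
    have h1 := ipm_le_of_nearly_minimal hF hA2 G μ (empirical fun i => x i ω) (hgG ω)
      (not_not.1 fun h => hωN (hN h))
    have h2 := hSle _ hωS
    rw [epsF]
    linarith

/-- The points of the ROC curve of a test against a generator close to `μ` lie below the bound. -/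
theorem le_rocBound_of_ipm_le {μ : Measure X} [IsProbabilityMeasure μ] (hF : F.Nonempty)
    (hFm : ∀ f ∈ F, Measurable f) (hA2 : IsEvenBounded F Δ) (hΓ : complexity F G μ ≠ ∞)
    {ν : ProbabilityMeasure X} (hν : ν ∈ G) (hspan : LogRatioInSpan F μ (ν : Measure X)) {m : ℕ}
    (hd : ipm F μ (ν : Measure X) ≤ epsF F G μ p L Δ τ m δ / 2) (A : AttackPolicy X)
    {z : ℝ × ℝ} (hz : z ∈ rocCurve A (ν : Measure X) μ) :
    z.2 ≤ rocBound (epsTV F G μ p L Δ τ m δ) z.1 := by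
  obtain ⟨t, rfl⟩ := hz
  refine le_min ?_ ?_
  · have h := integral_le_integral_add_of_mem hF hFm hA2 hΓ hν hspan (A t).measurable_accept
      (A t).accept_mem
    have hε : √((complexity F G μ).toReal * ipm F μ (ν : Measure X)) / 2
        ≤ epsTV F G μ p L Δ τ m δ := by
      have e : epsTV F G μ p L Δ τ m δ
          = √((complexity F G μ).toReal * (epsF F G μ p L Δ τ m δ / 2)) / 2 := by
        rw [epsTV, ← mul_div_assoc, Real.sqrt_div' _ zero_le_two, div_div, mul_comm (2 : ℝ) (√2)]
      rw [e]
      gcongr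
    simp only
    linarith
  · have hb : ∀ᵐ x ∂(ν : Measure X), ‖(A t).accept x‖ ≤ 1 := ae_of_all _ fun x => by
      rw [Real.norm_eq_abs, abs_of_nonneg ((A t).accept_mem x).1]
      exact ((A t).accept_mem x).2
    have h := norm_integral_le_of_norm_le_const hb
    simp only [probReal_univ, mul_one] at h
    exact (le_abs_self _).trans h

end Trained

end GanMIA

theorem mainTheorem2
    {X : Type*} [MeasurableSpace X] {Ω : Type*} [MeasurableSpace Ω]
    -- real distribution, discriminators, generators
    (μ : ProbabilityMeasure X) (F : Set (X → ℝ)) (G : Set (ProbabilityMeasure X))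
    (p : ℕ) (L Δ τ δ : ℝ)
    (hF : F.Nonempty) (hFm : ∀ f ∈ F, Measurable f)
    (hL : 0 ≤ L) (hA2 : GanMIA.IsEvenBounded F Δ) (hA3 : GanMIA.IsLipschitzParametrized F p L)
    (hspan : ∀ ν ∈ G, GanMIA.LogRatioInSpan F (μ : Measure X) (ν : Measure X))
    (hΓ : GanMIA.complexity F G (μ : Measure X) ≠ ∞)
    (hδ : 0 < δ) (hδ1 : δ < 1)
    -- `m` i.i.d. training samples from `μ`
    (P : Measure Ω) [IsProbabilityMeasure P] (m : ℕ) (hm : 0 < m) (x : Fin m → Ω → X)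
    (hxm : ∀ i, Measurable (x i)) (hxlaw : ∀ i, P.map (x i) = (μ : Measure X))
    (hxind : iIndepFun x P)
    -- the trained generator, with optimization error at most `τ`
    (g : Ω → ProbabilityMeasure X) (hgG : ∀ ω, g ω ∈ G)
    (hgopt : ∀ᵐ ω ∂P,
      GanMIA.ipm F (GanMIA.empirical fun i => x i ω) (g ω : Measure X) -
        (⨅ ν : G, GanMIA.ipm F (GanMIA.empirical fun i => x i ω) (ν.1 : Measure X)) ≤ τ) :
    -- given the trained generator, a training sample is distributed as a generated sample
    (∀ ω, GanMIA.memberLaw (μ : Measure X) (g ω : Measure X) m = (g ω : Measure X)) ∧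
    -- with probability at least `1 - δ`, the ROC curve of every attack lies below the bound
    (∃ E : Set Ω, MeasurableSet E ∧ ENNReal.ofReal (1 - δ) ≤ P E ∧
      ∀ ω ∈ E, ∀ A : GanMIA.AttackPolicy X,
        ∀ z ∈ GanMIA.rocCurve A
            (GanMIA.memberLaw (μ : Measure X) (g ω : Measure X) m) (μ : Measure X),
          z.2 ≤ GanMIA.rocBound (GanMIA.epsTV F G (μ : Measure X) p L Δ τ m δ) z.1) ∧
    -- the bound is tight
    (∃ μ' g' : ProbabilityMeasure ℝ,
      GanMIA.tvDist (μ' : Measure ℝ) (g' : Measure ℝ) =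
        min (GanMIA.epsTV F G (μ : Measure X) p L Δ τ m δ) 1 ∧
      ∃ A : GanMIA.AttackPolicy ℝ,
        GanMIA.rocCurve A (g' : Measure ℝ) (μ' : Measure ℝ) =
          (fun t => (t, GanMIA.rocBound (GanMIA.epsTV F G (μ : Measure X) p L Δ τ m δ) t)) ''
            Set.Icc (0 : ℝ) 1) ∧
    -- the excess over the approximation and optimization errors is of order `k ^ (-1/4)`
    (∀ k : ℕ, 0 < k →
      GanMIA.epsTV F G (μ : Measure X) p L Δ τ k δ ≤
        √((GanMIA.complexity F G (μ : Measure X)).toReal *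
            (GanMIA.approxErr F G (μ : Measure X) + τ)) / 2 +
          √((GanMIA.complexity F G (μ : Measure X)).toReal * GanMIA.genConst p L Δ δ) / 2 *
            (k : ℝ) ^ (-(1 / 4) : ℝ)) ∧
    -- with negligible approximation and optimization errors the bound is `O(k ^ (-1/4))`
    (∀ τ' : ℕ → ℝ,
      (fun k : ℕ => GanMIA.approxErr F G (μ : Measure X) + τ' k)
        =O[atTop] (fun k : ℕ => (k : ℝ) ^ (-(1 / 2) : ℝ)) →
      (fun k : ℕ => GanMIA.epsTV F G (μ : Measure X) p L Δ (τ' k) k δ)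
        =O[atTop] (fun k : ℕ => (k : ℝ) ^ (-(1 / 4) : ℝ))) := by
  have hmember : ∀ ω, GanMIA.memberLaw (μ : Measure X) (g ω : Measure X) m = (g ω : Measure X) :=
    fun ω => GanMIA.memberLaw_eq (hspan _ (hgG ω)).1 (hspan _ (hgG ω)).2.1 hm
  have hΔ : 0 ≤ Δ := by
    obtain ⟨f, hf⟩ := hF
    obtain ⟨y⟩ : Nonempty X := (μ : Measure X).nonempty_of_neZero
    exact (abs_nonneg _).trans (hA2.2 f hf y)
  refine ⟨hmember, ?_, GanMIA.exists_rocCurve_eq_graph (by unfold GanMIA.epsTV; positivity),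
    fun k _ => GanMIA.epsTV_le hL hΔ τ δ k, fun τ' hτ' => GanMIA.epsTV_isBigO hL hΔ δ hτ'⟩
  obtain ⟨E, hE, hPE, hd⟩ := GanMIA.exists_measurableSet_ipm_trained_le (μ : Measure X) hF hFm hL
    hA2 hA3 hδ hδ1 P hm x hxm hxlaw hxind g hgG hgopt
  refine ⟨E, hE, hPE, fun ω hω A z hz => ?_⟩
  rw [hmember ω] at hz
  exact GanMIA.le_rocBound_of_ipm_le hF hFm hA2 hΓ (hgG ω) (hspan _ (hgG ω)) (hd ω hω) A hz
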